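/- Let $\mu_4=\langle\zeta_4\rangle\subset\mathbf C^\times$ with $\zeta_4=e^{2\pi i/4}$, and regard $A_6$ as the subgroup of inner automorphisms of $\mathrm{Aut}(A_6)$. Let $M_{10}$ be the Mathieu group of degree $10$, i.e. the pointwise stabilizer of two points in the Mathieu group $M_{12}$ (the automorphism group of the Steiner system $S(5,6,12)$) acting on twelve points. For each of the groups $A_6$, $S_6$, $\mathrm{PGL}(2,9)$, $M_{10}$ the group $\mathrm{Aut}(A_6)$ has exactly one subgroup isomorphic to it, denoted by the same symbol; $S_6$ acts on $A_6$ by conjugation. For an exact sequence $1\to A_6\to G\xrightarrow{\alpha}\mu_4\to 1$ let $c:G\to\mathrm{Aut}(A_6)$, $c(g)(a)=gag^{-1}$, and $N=c(G)$. Then $N$ is one of $A_6$, $S_6$, $\mathrm{PGL}(2,9)$, $M_{10}$, and $G$ is isomorphic to the subgroup $(A_6\times 1)\cdot\langle\tilde g\rangle$ of $N\times\mu_4$, where 1. if $N=A_6$: $\tilde g=(1,\zeta_4)$, and the subgroup is $A_6\times\mu_4$; 2. if $N=S_6$: $\tilde g=(g,\zeta_4)$ with $g=(1\,2)\in S_6$;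 3. if $N=\mathrm{PGL}(2,9)$: $\tilde g=(h^5,\zeta_4)$, with $h$ any element of order $10$ of $\mathrm{PGL}(2,9)$; 4. if $N=M_{10}$: $\tilde g=(g,\zeta_4)$, with $g$ any element of order $4$ of $M_{10}\setminus A_6$. Such elements $h$ and $g$ exist. In each case $\tilde g$ has order $4$ and the subgroup is the semidirect product $A_6:\langle\tilde g\rangle$, with $\tilde g$ acting on $A_6$ through its first component. With the inclusion of $A_6\times 1$ and the second projection it is an extension of $\mu_4$ by $A_6$ whose image in $\mathrm{Aut}(A_6)$ is the given $N$. The groups in 1.–4., denoted $A_6(4)$, $S_6(2)$, $\mathrm{PGL}(2,9)(2)$, $M_{10}(2)$, are pairwise non-isomorphic. Hence there are, up to isomorphism, exactly four groups $G$ fitting into an exact sequence $1\to A_6\to G\to\mu_4\to1$, and two such groups are isomorphic if and only if they have the same image $N$. -/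

import Mathlib

open scoped Pointwise MatrixGroups OnePoint

namespace A6Ext

/-- The alternating group of degree 6. -/
abbrev A6 : Type := alternatingGroup (Fin 6)

/-- The group of complex fourth roots of unity. -/
abbrev Mu4 : Type := rootsOfUnity 4 ℂ

/-- The generator `exp (2πi/4)` of `Mu4`. -/
noncomputable def zeta4 : Mu4 :=
  rootsOfUnity.mkOfPowEq (Complex.exp (2 * Real.pi * Complex.I / 4)) (by
    have h := (Complex.isPrimitiveRoot_exp 4 (by norm_num)).pow_eq_one
    simpa using h)

/-- The inner automorphisms of `A6`, i.e. `A6` viewed as a normal subgroup of `Aut(A6)`. -/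
def inn : Subgroup (MulAut A6) := (MulAut.conj : A6 →* MulAut A6).range

/-! ### The Mathieu groups of degree 12 and 10 -/

instance fact_prime_eleven : Fact (Nat.Prime 11) := ⟨by norm_num⟩

/-- The projective line over the field with 11 elements: the twelve points on which the Mathieu
group of degree 12 acts. -/
abbrev Points : Type := OnePoint (ZMod 11)

/-- The six-element set consisting of `∞` and the nonzero squares modulo 11. -/
def baseHexad : Set Points :=
  {∞, ((1 : ZMod 11) : Points), ((3 : ZMod 11) : Points), ((4 : ZMod 11) : Points),
    ((5 : ZMod 11) : Points), ((9 : ZMod 11) : Points)}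

/-- The 132 hexads of the Steiner system `S(5,6,12)`: the images of `baseHexad` under the Möbius
transformations of determinant 1. -/
def hexads : Set (Set Points) :=
  Set.range fun g : Matrix.SpecialLinearGroup (Fin 2) (ZMod 11) =>
    (fun x : Points => (g : GL (Fin 2) (ZMod 11)) • x) '' baseHexad

/-- The Mathieu group of degree 12, the automorphism group of the Steiner system `S(5,6,12)`. -/
def M12 : Subgroup (Equiv.Perm Points) := MulAction.stabilizer (Equiv.Perm Points) hexads

/-- The Mathieu group of degree 10, the pointwise stabilizer of two points in `M12`. -/
def M10 : Subgroup (Equiv.Perm Points) :=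
  M12 ⊓ fixingSubgroup (Equiv.Perm Points) {∞, ((0 : ZMod 11) : Points)}

/-! ### The four candidates for the image of the conjugation homomorphism -/

/-- Labels of the four groups `A₆`, `S₆`, `PGL(2,9)`, `M₁₀`. -/
inductive Kind : Type
  | A6
  | S6
  | PGL29
  | M10

/-- `N` is a subgroup of `Aut(A6)` isomorphic to the group labelled by the given kind. -/
def IsCandidate : Kind → Subgroup (MulAut A6) → Prop
  | .A6, N => Nonempty (N ≃* A6)
  | .S6, N => Nonempty (N ≃* Equiv.Perm (Fin 6))
  | .PGL29, N => Nonempty (N ≃* PGL(2, GaloisField 3 2))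
  | .M10, N => Nonempty (N ≃* A6Ext.M10)

/-- The admissible first components `g` of the generator `(g, zeta4)` for each kind of `N`:
the identity; conjugation by the transposition of the first two points; the fifth power of
an element of order 10 of `N`; an element of order 4 of `N` that is not inner. -/
def IsFirstComponent : Kind → Subgroup (MulAut A6) → MulAut A6 → Prop
  | .A6, _, g => g = 1
  | .S6, _, g => g = (MulAut.conjNormal (Equiv.swap (0 : Fin 6) 1) : MulAut A6)
  | .PGL29, N, g => ∃ h ∈ N, orderOf h = 10 ∧ g = h ^ 5
  | .M10, N, g => g ∈ N ∧ g ∉ inn ∧ orderOf g = 4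

/-! ### The model groups -/

/-- The element `(g, zeta4)` of `Aut(A6) × Mu4`. -/
noncomputable def lift (g : MulAut A6) : MulAut A6 × Mu4 := (g, zeta4)

/-- The subgroup of `Aut(A6) × Mu4` generated by `A6 × 1` and `(g, zeta4)`. -/
noncomputable def model (g : MulAut A6) : Subgroup (MulAut A6 × Mu4) :=
  inn.prod ⊥ ⊔ Subgroup.zpowers (lift g)

/-- The action of the cyclic group generated by `(g, zeta4)` on `A6` through the first component;
this is its conjugation action on `A6 × 1`. -/
noncomputable def action (g : MulAut A6) : Subgroup.zpowers (lift g) →* MulAut A6 :=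
  (MonoidHom.fst (MulAut A6) Mu4).comp (Subgroup.zpowers (lift g)).subtype

end A6Ext

/-!
The conjugation action `c` of an extension `G` is faithful on the centreless kernel, so together
with the projection it embeds `G` into `Aut(A6) × Mu4`; the image is generated by `A6 × 1` and one
element `(g, zeta4)`, and depends on `g` only modulo `A6`. Since `Aut(A6)/A6` is a Klein
four-group, there are four possible cosets, one for each of the four subgroups
`N = A6 ⊔ ⟨g⟩`: these are `A6` and its three overgroups of index two. An isomorphism between two
such groups `G` carries the commutator subgroup `A6` to `A6`, so some automorphism of `A6`
conjugates one image `N` to the other; both are normal, hence equal.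

The structure of `Aut(A6)` comes from embeddings of `A6` as a subgroup of index two into `S6`,
`PGL(2, 9)` and `M10`, each of which thereby acts faithfully on `A6`. The last two embeddings label
the ten points on which the group acts by the ten bisections `{s, sᶜ}` of six points into triples,
so that generators of `A6` act on the labels as elements of the group. The three overgroups are
told apart by whether they contain elements of order eight, and elements of order four outside `A6`.
-/

namespace A6Ext

open Equiv

/-! ### Automorphisms of the alternating group of degree six -/

theorem conj_injective {G : Type*} [Group G] (hG : Subgroup.center G = ⊥) :
    Function.Injective (MulAut.conj : G →* MulAut G) := by
  rw [injective_iff_map_eq_one]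
  intro g hg
  rw [← Subgroup.mem_bot, ← hG, Subgroup.mem_center_iff]
  intro x
  have hx := DFunLike.congr_fun hg x
  rw [MulAut.conj_apply, MulAut.one_apply, mul_inv_eq_iff_eq_mul] at hx
  exact hx.symm

instance isPerfect_A6 : Group.IsPerfect A6 := ⟨commutator_alternatingGroup_eq_top (by simp)⟩

theorem center_A6 : Subgroup.center A6 = ⊥ := alternatingGroup.center_eq_bot (by simp)

theorem card_A6 : Nat.card A6 = 360 := by
  rw [nat_card_alternatingGroup, Nat.card_eq_fintype_card, Fintype.card_fin]
  rfl

theorem orderOf_dvd_twelve_or_eq_five (σ : Perm (Fin 6)) : orderOf σ ∣ 12 ∨ orderOf σ = 5 := by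
  have hsum : σ.cycleType.sum ≤ 6 := σ.sum_cycleType ▸ Finset.card_le_univ _
  by_cases h5 : 5 ∈ σ.cycleType
  · obtain ⟨s, hs⟩ := Multiset.exists_cons_of_mem h5
    have hs0 : s = 0 := by
      refine Multiset.eq_zero_of_forall_notMem fun n hn => ?_
      have h2 := σ.two_le_of_mem_cycleType (hs ▸ Multiset.mem_cons_of_mem hn)
      have h3 := Multiset.le_sum_of_mem hn
      rw [hs, Multiset.sum_cons] at hsum
      omega
    right
    rw [← σ.lcm_cycleType, hs, hs0]
    rfl
  · left
    rw [← σ.lcm_cycleType, Multiset.lcm_dvd]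
    intro n hn
    have h2 := σ.two_le_of_mem_cycleType hn
    have h6 := (Multiset.le_sum_of_mem hn).trans hsum
    have hn5 : n ≠ 5 := fun h => h5 (h ▸ hn)
    interval_cases n <;> first | exact absurd rfl hn5 | norm_num

theorem orderOf_ne_eight (σ : Perm (Fin 6)) : orderOf σ ≠ 8 := fun h => by
  rcases orderOf_dvd_twelve_or_eq_five σ with h' | h' <;> rw [h] at h' <;> norm_num at h'

theorem orderOf_A6_dvd_twelve_or_eq_five (a : A6) : orderOf a ∣ 12 ∨ orderOf a = 5 :=
  Subgroup.orderOf_coe a ▸ orderOf_dvd_twelve_or_eq_five a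

theorem orderOf_A6_ne_eight (a : A6) : orderOf a ≠ 8 := fun h => by
  rcases orderOf_A6_dvd_twelve_or_eq_five a with h' | h' <;> rw [h] at h' <;> norm_num at h'

theorem injective_of_map_ne_one {X : Type*} [Group X] {f : A6 →* X} {a : A6} (h : f a ≠ 1) :
    Function.Injective f := by
  have simple : IsSimpleGroup A6 := alternatingGroup.isSimpleGroup (by simp)
  refine (MonoidHom.ker_eq_bot_iff f).1 (f.normal_ker.eq_bot_or_eq_top.resolve_right fun hf => ?_)
  exact h (MonoidHom.mem_ker.1 (hf ▸ Subgroup.mem_top a))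

/-- The cycle `(0 1 2 3 4)`. -/
def fiveCycle : Perm (Fin 6) where
  toFun := ![1, 2, 3, 4, 0, 5]
  invFun := ![4, 0, 1, 2, 3, 5]
  left_inv := by decide
  right_inv := by decide

/-- The cycle `(0 1 5)`. -/
def threeCycle : Perm (Fin 6) where
  toFun := ![1, 5, 2, 3, 4, 0]
  invFun := ![5, 0, 2, 3, 4, 1]
  left_inv := by decide
  right_inv := by decide

/-- The product `(0 1 3)(2 4 5)`, the image of `threeCycle` under an outer automorphism of `A6`
fixing `fiveCycle`. -/
def doubleThreeCycle : Perm (Fin 6) where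
  toFun := ![1, 3, 4, 0, 5, 2]
  invFun := ![3, 0, 5, 1, 2, 4]
  left_inv := by decide
  right_inv := by decide

/-- `fiveCycle` as an element of `A6`. -/
def genA : A6 := ⟨fiveCycle, by rw [Perm.mem_alternatingGroup]; decide +kernel⟩

/-- `threeCycle` as an element of `A6`. -/
def genB : A6 := ⟨threeCycle, by rw [Perm.mem_alternatingGroup]; decide +kernel⟩

/-- `doubleThreeCycle` as an element of `A6`. -/
def genC : A6 := ⟨doubleThreeCycle, by rw [Perm.mem_alternatingGroup]; decide +kernel⟩

theorem exists_mem_closure_apply_eq_zero_one {a b : Fin 6} (hab : a ≠ b) :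
    ∃ g ∈ Subgroup.closure {fiveCycle, threeCycle}, g a = 0 ∧ g b = 1 := by
  have word : ∀ a b : Fin 6, a ≠ b → ∃ i j k : Fin 5,
      let g := fiveCycle ^ (i : ℕ) * threeCycle * fiveCycle ^ (j : ℕ) * threeCycle *
        fiveCycle ^ (k : ℕ)
      g a = 0 ∧ g b = 1 := by
    decide +kernel
  have hx : fiveCycle ∈ Subgroup.closure {fiveCycle, threeCycle} :=
    Subgroup.subset_closure (by simp)
  have hy : threeCycle ∈ Subgroup.closure {fiveCycle, threeCycle} :=
    Subgroup.subset_closure (by simp)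
  obtain ⟨i, j, k, hg⟩ := word a b hab
  exact ⟨_, mul_mem (mul_mem (mul_mem (mul_mem (pow_mem hx _) hy) (pow_mem hx _)) hy)
    (pow_mem hx _), hg⟩

theorem alternatingGroup_le_closure :
    alternatingGroup (Fin 6) ≤ Subgroup.closure {fiveCycle, threeCycle} := by
  have two_transitive : MulAction.IsMultiplyPretransitive
      (Subgroup.closure {fiveCycle, threeCycle}) (Fin 6) 2 := by
    rw [MulAction.is_two_pretransitive_iff]
    intro a b c d hab hcd
    obtain ⟨g, hg, ga, gb⟩ := exists_mem_closure_apply_eq_zero_one hab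
    obtain ⟨k, hk, kc, kd⟩ := exists_mem_closure_apply_eq_zero_one hcd
    refine ⟨⟨k⁻¹ * g, mul_mem (inv_mem hk) hg⟩, ?_, ?_⟩
    · rw [Subgroup.mk_smul, Perm.smul_def, Perm.mul_apply, ga, Perm.inv_eq_iff_eq, kc]
    · rw [Subgroup.mk_smul, Perm.smul_def, Perm.mul_apply, gb, Perm.inv_eq_iff_eq, kd]
  have three : threeCycle.IsThreeCycle := by
    rw [show threeCycle = swap 1 0 * swap 1 5 by decide]
    exact Perm.isThreeCycle_swap_mul_swap_same (by decide) (by decide) (by decide)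
  exact Perm.alternatingGroup_le_of_isPreprimitive_of_isThreeCycle_mem
    (MulAction.isPreprimitive_of_is_two_pretransitive two_transitive) three
    (Subgroup.subset_closure (by simp))

theorem closure_genA_genB : Subgroup.closure {genA, genB} = (⊤ : Subgroup A6) := by
  apply Subgroup.map_injective (Subgroup.subtype_injective _)
  rw [MonoidHom.map_closure, ← MonoidHom.range_eq_map, Subgroup.range_subtype, Set.image_pair]
  refine le_antisymm ?_ alternatingGroup_le_closure
  rw [Subgroup.closure_le]
  rintro _ (rfl | rfl)
  · exact genA.2
  · exact genB.2

/-- The action of the symmetric group on `A6` by conjugation. -/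
def symAut : Perm (Fin 6) →* MulAut A6 := MulAut.conjNormal

theorem coe_symAut (σ : Perm (Fin 6)) (a : A6) : (symAut σ a : Perm (Fin 6)) = σ * a * σ⁻¹ :=
  MulAut.conjNormal_apply σ a

theorem symAut_coe (a : A6) : symAut a = MulAut.conj a := by
  ext b
  rw [coe_symAut]
  rfl

theorem symAut_injective : Function.Injective symAut := by
  rw [injective_iff_map_eq_one]
  intro σ hσ
  have commute : ∀ a : A6, σ * a = a * σ := fun a => by
    rw [← mul_inv_eq_iff_eq_mul, ← coe_symAut, hσ, MulAut.one_apply]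
  exact (by decide +kernel : ∀ σ : Perm (Fin 6), σ * fiveCycle = fiveCycle * σ →
    σ * threeCycle = threeCycle * σ → σ = 1) σ (commute genA) (commute genB)

theorem mulAut_A6_ext {φ ψ : MulAut A6} (hA : φ genA = ψ genA) (hB : φ genB = ψ genB) : φ = ψ := by
  refine MulEquiv.toMonoidHom_injective (MonoidHom.eq_of_eqOn_dense closure_genA_genB ?_)
  rintro _ (rfl | rfl)
  · exact hA
  · exact hB

/-- The relations that `genB` satisfies together with `genA` leave, up to conjugation by powers of
`fiveCycle`, two possibilities for its image under an automorphism that fixes `genA`. -/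
theorem eq_conj_threeCycle_or_doubleThreeCycle : ∀ z : Perm (Fin 6), z ≠ 1 → z ^ 3 = 1 →
    (fiveCycle * z * fiveCycle ^ 3 * z) ^ 3 = 1 → (fiveCycle⁻¹ * z) ^ 5 = 1 →
    ∃ k : Fin 5, z = fiveCycle ^ (k : ℕ) * threeCycle * (fiveCycle ^ (k : ℕ))⁻¹ ∨
      z = fiveCycle ^ (k : ℕ) * doubleThreeCycle * (fiveCycle ^ (k : ℕ))⁻¹ := by
  decide +kernel

theorem orderOf_fiveCycle : orderOf fiveCycle = 5 :=
  orderOf_eq_prime (hp := ⟨by norm_num⟩) (by decide +kernel) (by decide +kernel)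

theorem isConj_fiveCycle_of_orderOf_eq_five {σ : Perm (Fin 6)} (hσ : orderOf σ = 5) :
    IsConj fiveCycle σ := by
  have cycleType_eq : ∀ τ : Perm (Fin 6), orderOf τ = 5 → τ.cycleType = {5} := fun τ hτ => by
    have cycle : τ.IsCycle := Perm.isCycle_of_prime_order' (by rw [hτ]; norm_num) (by simp [hτ])
    rw [cycle.cycleType, ← cycle.orderOf, hτ]
  rw [Perm.isConj_iff_cycleType_eq, cycleType_eq _ hσ, cycleType_eq _ orderOf_fiveCycle]

theorem exists_symAut_mul_apply_genA (φ : MulAut A6) : ∃ σ, (symAut σ * φ) genA = genA := by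
  have order : orderOf (φ genA : Perm (Fin 6)) = 5 := by
    rw [Subgroup.orderOf_coe, MulEquiv.orderOf_eq, ← Subgroup.orderOf_coe]
    exact orderOf_fiveCycle
  obtain ⟨σ, hσ⟩ := isConj_iff.1 (isConj_fiveCycle_of_orderOf_eq_five order).symm
  exact ⟨σ, Subtype.ext ((coe_symAut σ _).trans hσ)⟩

theorem exists_symAut_mul_apply_genB (φ : MulAut A6) (hA : φ genA = genA) :
    ∃ σ, (symAut σ * φ) genA = genA ∧
      ((symAut σ * φ) genB = genB ∨ (symAut σ * φ) genB = genC) := by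
  have relation : ∀ w : A6, w = 1 → (φ w : Perm (Fin 6)) = 1 := fun w hw => by simp [hw]
  have rel₁ := relation (genB ^ 3) (by decide +kernel)
  have rel₂ := relation ((genA * genB * genA ^ 3 * genB) ^ 3) (by decide +kernel)
  have rel₃ := relation ((genA⁻¹ * genB) ^ 5) (by decide +kernel)
  have ne : (φ genB : Perm (Fin 6)) ≠ 1 := by
    rw [ne_eq, OneMemClass.coe_eq_one, map_eq_one_iff _ φ.injective]
    decide +kernel
  simp only [map_mul, map_pow, map_inv, hA] at rel₁ rel₂ rel₃
  obtain ⟨k, hk⟩ := eq_conj_threeCycle_or_doubleThreeCycle _ ne rel₁ rel₂ rel₃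
  refine ⟨(fiveCycle ^ (k : ℕ))⁻¹, ?_, hk.imp (fun h => ?_) (fun h => ?_)⟩ <;>
    apply Subtype.ext <;> rw [MulAut.mul_apply, coe_symAut]
  · rw [hA, inv_inv, mul_assoc, inv_mul_eq_iff_eq_mul]
    exact ((Commute.refl fiveCycle).pow_right k).eq
  all_goals
    rw [h]
    group
    rfl

theorem exists_symAut_mul (φ : MulAut A6) : ∃ σ, (symAut σ * φ) genA = genA ∧
    ((symAut σ * φ) genB = genB ∨ (symAut σ * φ) genB = genC) := by
  obtain ⟨σ, hσ⟩ := exists_symAut_mul_apply_genA φ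
  obtain ⟨τ, hτ⟩ := exists_symAut_mul_apply_genB _ hσ
  exact ⟨τ * σ, by rwa [map_mul, mul_assoc]⟩

theorem mul_inv_mem_range_symAut {φ ψ : MulAut A6} (hφ : φ ∉ symAut.range)
    (hψ : ψ ∉ symAut.range) : φ * ψ⁻¹ ∈ symAut.range := by
  have normalize : ∀ χ ∉ symAut.range, ∃ σ, (symAut σ * χ) genA = genA ∧
      (symAut σ * χ) genB = genC := by
    intro χ hχ
    obtain ⟨σ, hA, hB⟩ := exists_symAut_mul χ
    refine ⟨σ, hA, hB.resolve_left fun hB => hχ ⟨σ⁻¹, ?_⟩⟩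
    rw [map_inv, inv_eq_iff_mul_eq_one]
    exact mulAut_A6_ext hA hB
  obtain ⟨σ, hA, hB⟩ := normalize φ hφ
  obtain ⟨τ, hA', hB'⟩ := normalize ψ hψ
  refine ⟨σ⁻¹ * τ, ?_⟩
  rw [map_mul, map_inv, eq_mul_inv_iff_mul_eq, mul_assoc, inv_mul_eq_iff_eq_mul]
  exact mulAut_A6_ext (hA'.trans hA.symm) (hB'.trans hB.symm)

/-! ### Recognizing groups that contain a centreless group with index two -/

section Recognition

variable {A G X Y Z : Type*} [Group A] [Group G] [Group X]

/-- If generators of `G` act on the image of an injective labelling `lab : Z → Y` through elements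
of a group `X` acting faithfully on `Z`, then all of `G` does. -/
theorem exists_hom_of_equivariant [MulAction G Y] [MulAction X Z] [FaithfulSMul X Z] {lab : Z → Y}
    (hlab : Function.Injective lab) {S : Set G} (hS : Subgroup.closure S = ⊤)
    (h : ∀ s ∈ S, ∃ x : X, ∀ z, s • lab z = lab (x • z)) :
    ∃ ι : G →* X, ∀ g z, lab (ι g • z) = g • lab z := by
  have exists_lift : ∀ g : G, ∃ x : X, ∀ z, lab (x • z) = g • lab z := by
    intro g
    have hg : g ∈ Subgroup.closure S := hS ▸ Subgroup.mem_top g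
    induction hg using Subgroup.closure_induction with
    | mem s hs => exact (h s hs).imp fun x hx z => (hx z).symm
    | one => exact ⟨1, fun z => by simp only [one_smul]⟩
    | mul a b _ _ ha hb =>
      obtain ⟨x, hx⟩ := ha
      obtain ⟨y, hy⟩ := hb
      exact ⟨x * y, fun z => by rw [mul_smul, hx, hy, mul_smul]⟩
    | inv a _ ha =>
      obtain ⟨x, hx⟩ := ha
      exact ⟨x⁻¹, fun z => by rw [eq_inv_smul_iff, ← hx, smul_inv_smul]⟩
  choose ι hι using exists_lift
  exact ⟨MonoidHom.mk' ι fun a b => eq_of_smul_eq_smul fun z => hlab <| by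
    rw [hι, mul_smul, mul_smul, hι, hι], hι⟩

theorem card_le_descFactorial [MulAction X Y] (T : Finset Y) (hT : ∀ (x : X), ∀ y ∈ T, x • y ∈ T)
    {k : ℕ} (s : Fin k ↪ Y) (hsT : ∀ i, s i ∈ T) (hs : ∀ x : X, (∀ i, x • s i = s i) → x = 1) :
    Nat.card X ≤ T.card.descFactorial k := by
  let orbit : X → Fin k ↪ T := fun x =>
    ⟨fun i => ⟨x • s i, hT x _ (hsT i)⟩, fun i j hij => s.injective <|
      smul_left_cancel x (congrArg Subtype.val hij)⟩
  have injective : Function.Injective orbit := by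
    intro x y hxy
    refine (inv_mul_eq_one.1 (hs (y⁻¹ * x) fun i => ?_)).symm
    rw [mul_smul, inv_smul_eq_iff]
    exact congrArg Subtype.val (DFunLike.congr_fun hxy i)
  calc Nat.card X ≤ Nat.card (Fin k ↪ T) := Nat.card_le_card_of_injective _ injective
    _ = T.card.descFactorial k := by
      rw [Nat.card_eq_fintype_card, Fintype.card_embedding_eq, Fintype.card_coe, Fintype.card_fin]

theorem index_range_eq_two [Finite X] (hX : Nat.card X ≤ 2 * Nat.card A) {ι : A →* X}
    (hι : Function.Injective ι) {u : X} (hu : u ∉ ι.range) : ι.range.index = 2 := by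
  have card_range : Nat.card ι.range = Nat.card A :=
    (Nat.card_congr (MonoidHom.ofInjective hι).toEquiv).symm
  have finite : Finite A := Finite.of_injective ι hι
  have ne_one : ι.range.index ≠ 1 := fun h => hu (Subgroup.index_eq_one.1 h ▸ Subgroup.mem_top u)
  have ne_zero : ι.range.index ≠ 0 := Subgroup.index_ne_zero_of_finite
  rw [← card_range, ← ι.range.card_mul_index, mul_comm] at hX
  have := Nat.le_of_mul_le_mul_right hX Nat.card_pos
  omega

theorem card_eq_two_mul [Finite X] (hX : Nat.card X ≤ 2 * Nat.card A) {ι : A →* X}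
    (hι : Function.Injective ι) {u : X} (hu : u ∉ ι.range) : Nat.card X = 2 * Nat.card A := by
  rw [← ι.range.index_mul_card, index_range_eq_two hX hι hu,
    Nat.card_congr (MonoidHom.ofInjective hι).toEquiv]

theorem exists_mulAut_extending_conj {ι : A →* X} (hι : Function.Injective ι)
    (hn : ι.range.Normal) : ∃ c : X →* MulAut A, ∀ a, c (ι a) = MulAut.conj a := by
  let e : A ≃* ι.range := MonoidHom.ofInjective hι
  refine ⟨(MulAut.congr e.symm).toMonoidHom.comp MulAut.conjNormal, fun a => ?_⟩
  ext b
  change e.symm (MulAut.conjNormal (ι a) (e b)) = a * b * a⁻¹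
  rw [MulEquiv.symm_apply_eq]
  ext
  simp only [e, MulAut.conjNormal_apply, MonoidHom.ofInjective_apply, map_mul, map_inv,
    Subgroup.coe_mul, InvMemClass.coe_inv]

theorem notMem_range_of_orderOf_ne {ι : A →* X} (hι : Function.Injective ι) {u : X}
    (hu : ∀ a : A, orderOf a ≠ orderOf u) : u ∉ ι.range := by
  rintro ⟨a, rfl⟩
  exact hu a (orderOf_injective ι hι a).symm

/-- The square of `u` lies in the image of `A`, on which conjugation is faithful; so `u` still has
order `2 ^ (n + 2)` as an automorphism and is not inner, and the image of `X` in `MulAut A` is as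
large as `X`. -/
theorem exists_injective_mulAut [Finite X] (hA : Subgroup.center A = ⊥)
    (hX : Nat.card X ≤ 2 * Nat.card A) {ι : A →* X} (hι : Function.Injective ι) {n : ℕ} {u : X}
    (hu : orderOf u = 2 ^ (n + 2)) (hA' : ∀ a : A, orderOf a ≠ 2 ^ (n + 2)) :
    ∃ c : X →* MulAut A, Function.Injective c ∧ ∀ a, c (ι a) = MulAut.conj a := by
  have hur : u ∉ ι.range := notMem_range_of_orderOf_ne hι (hu ▸ hA')
  have hidx := index_range_eq_two hX hι hur
  obtain ⟨c, hc⟩ := exists_mulAut_extending_conj hι (Subgroup.normal_of_index_eq_two hidx)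
  obtain ⟨a, ha⟩ := Subgroup.sq_mem_of_index_two hidx u
  have hpow : u ^ 2 ^ (n + 1) = ι (a ^ 2 ^ n) := by rw [pow_succ', pow_mul, ← ha, map_pow]
  have order_conj : orderOf (c u) = 2 ^ (n + 2) := by
    refine orderOf_eq_prime_pow (fun h => ?_) ?_
    · rw [← map_pow, hpow, hc, map_eq_one_iff _ (conj_injective hA)] at h
      have := orderOf_dvd_of_pow_eq_one (hpow.trans ((congrArg ι h).trans (map_one ι)))
      rw [hu, Nat.pow_dvd_pow_iff_le_right (by norm_num)] at this
      omega
    · rw [← map_pow, ← hu, pow_orderOf_eq_one, map_one]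
  have finite : Finite A := Finite.of_injective ι hι
  let κ : A →* c.range := MulAut.conj.codRestrict c.range fun a => ⟨ι a, hc a⟩
  have hκ : Function.Injective κ := fun a b h => conj_injective hA (congrArg Subtype.val h)
  have card_range : Nat.card c.range = 2 * Nat.card A := by
    refine card_eq_two_mul ((Nat.card_le_card_of_surjective _ c.rangeRestrict_surjective).trans hX)
      hκ (u := ⟨c u, u, rfl⟩) (notMem_range_of_orderOf_ne hκ ?_)
    rwa [← Subgroup.orderOf_coe, order_conj]
  have bijective := (Nat.bijective_iff_surjective_and_card c.rangeRestrict).2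
    ⟨c.rangeRestrict_surjective, (card_eq_two_mul hX hι hur).trans card_range.symm⟩
  exact ⟨c, fun x y h => bijective.1 (Subtype.ext h), hc⟩

end Recognition

/-! ### Perfect subgroups and subgroups of index two -/

section Subgroups

variable {A G : Type*} [Group A] [Group G]

theorem range_le_of_commutator_le [Group.IsPerfect A] {H : Subgroup G} (hH : commutator G ≤ H)
    (f : A →* G) : f.range ≤ H := by
  have : Group.IsPerfect f.range := .range f
  rw [← Subgroup.commutator_eq_self (H := f.range)]
  exact (Subgroup.commutator_mono le_top le_top).trans hH

theorem commutator_le_of_index_eq_four {H : Subgroup G} [H.Normal] (hH : H.index = 4) :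
    commutator G ≤ H := by
  have : Fact (Nat.Prime 2) := ⟨Nat.prime_two⟩
  have : Finite (G ⧸ H) := Nat.finite_of_card_ne_zero (by rw [← Subgroup.index, hH]; norm_num)
  exact Subgroup.Normal.quotient_commutative_iff_commutator_le.1
    (IsPGroup.isMulCommutative_of_card_eq_prime_sq (p := 2) hH)

theorem eq_of_le_of_index_eq {H K : Subgroup G} (hHK : H ≤ K) (h : H.index = K.index)
    (h0 : K.index ≠ 0) : H = K := by
  have mul_index := Subgroup.relIndex_mul_index hHK
  rw [h, Nat.mul_eq_right h0] at mul_index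
  exact le_antisymm hHK (Subgroup.relIndex_eq_one.1 mul_index)

theorem eq_or_eq_of_relIndex_prime {H K L : Subgroup G} (hHK : H ≤ K) (hKL : K ≤ L)
    (hp : (H.relIndex L).Prime) : K = H ∨ K = L := by
  have mul_relIndex := Subgroup.relIndex_mul_relIndex H K L hHK hKL
  rcases (Nat.dvd_prime hp).1 ⟨_, mul_relIndex.symm⟩ with h | h
  · exact .inl (le_antisymm (Subgroup.relIndex_eq_one.1 h) hHK)
  · rw [h, Nat.mul_eq_left hp.ne_zero] at mul_relIndex
    exact .inr (le_antisymm hKL (Subgroup.relIndex_eq_one.1 mul_relIndex))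

theorem inf_eq_of_index_eq_two {H M N : Subgroup G} (hH : H.index = 4) (hM : M.index = 2)
    (hN : N.index = 2) (hHM : H ≤ M) (hHN : H ≤ N) (hMN : M ≠ N) : M ⊓ N = H := by
  have prime : (H.relIndex M).Prime := by
    have := Subgroup.relIndex_mul_index hHM
    rw [hM, hH] at this
    rw [show H.relIndex M = 2 by omega]
    exact Nat.prime_two
  refine (eq_or_eq_of_relIndex_prime (le_inf hHM hHN) inf_le_left prime).resolve_right fun h => ?_
  exact hMN (eq_of_le_of_index_eq (inf_eq_left.1 h) (hM.trans hN.symm) (by rw [hN]; norm_num))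

/-- The quotient by `H` is a Klein four-group, the union of its three subgroups of order two. -/
theorem mem_or_mem_of_index_eq_two {H S P M : Subgroup G} (hH : H.index = 4) (hS : S.index = 2)
    (hP : P.index = 2) (hM : M.index = 2) (hHS : H ≤ S) (hHP : H ≤ P) (hHM : H ≤ M) (hSP : S ≠ P)
    (hMS : M ≠ S) (hMP : M ≠ P) (x : G) : x ∈ S ∨ x ∈ P ∨ x ∈ M := by
  by_contra! hx
  obtain ⟨m, hm, hmS⟩ := SetLike.not_le_iff_exists.1 fun h : M ≤ S =>
    hMS (eq_of_le_of_index_eq h (hM.trans hS.symm) (by rw [hS]; norm_num))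
  have hmP : m ∉ P := fun h =>
    hmS (hHS (inf_eq_of_index_eq_two hH hM hP hHM hHP hMP ▸ ⟨hm, h⟩))
  have hxm : x * m ∈ S ⊓ P :=
    ⟨(Subgroup.mul_mem_iff_of_index_two hS).2 (iff_of_false hx.1 hmS),
      (Subgroup.mul_mem_iff_of_index_two hP).2 (iff_of_false hx.2.1 hmP)⟩
  rw [inf_eq_of_index_eq_two hH hS hP hHS hHP hSP] at hxm
  exact hx.2.2 ((mul_mem_cancel_right hm).1 (hHM hxm))

theorem eq_or_eq_of_index_eq_two {H S P M N : Subgroup G} (hH : H.index = 4) (hS : S.index = 2)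
    (hP : P.index = 2) (hM : M.index = 2) (hN : N.index = 2) (hHS : H ≤ S) (hHP : H ≤ P)
    (hHM : H ≤ M) (hHN : H ≤ N) (hSP : S ≠ P) (hMS : M ≠ S) (hMP : M ≠ P) :
    N = S ∨ N = P ∨ N = M := by
  by_contra! h
  refine h.2.2 (eq_of_le_of_index_eq (fun x hx => ?_) (hN.trans hM.symm) (by rw [hM]; norm_num))
  rcases mem_or_mem_of_index_eq_two hH hS hP hM hHS hHP hHM hSP hMS hMP x with hxS | hxP | hxM
  · exact hHM (inf_eq_of_index_eq_two hH hN hS hHN hHS h.1 ▸ ⟨hx, hxS⟩)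
  · exact hHM (inf_eq_of_index_eq_two hH hN hP hHN hHP h.2.1 ▸ ⟨hx, hxP⟩)
  · exact hxM

theorem mul_inv_mem_of_sup_zpowers_eq {H : Subgroup G} [H.Normal] (sq_mem : ∀ g : G, g ^ 2 ∈ H)
    {x y : G} (h : H ⊔ Subgroup.zpowers x = H ⊔ Subgroup.zpowers y) : x * y⁻¹ ∈ H := by
  by_cases hy : y ∈ H
  · rw [sup_eq_left.2 (Subgroup.zpowers_le.2 hy), sup_eq_left, Subgroup.zpowers_le] at h
    exact mul_mem h (inv_mem hy)
  · have even_mem (g : G) (m : ℤ) : g ^ (2 * m) ∈ H := by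
      rw [zpow_mul, zpow_ofNat]
      exact zpow_mem (sq_mem g) m
    have hyx : y ∈ H ⊔ Subgroup.zpowers x := h ▸ Subgroup.mem_sup_right (Subgroup.mem_zpowers y)
    rw [Subgroup.mem_sup_of_normal_left] at hyx
    obtain ⟨a, ha, _, ⟨n, rfl⟩, rfl⟩ := hyx
    obtain ⟨m, rfl | rfl⟩ := n.even_or_odd'
    · exact absurd (mul_mem ha (even_mem x m)) hy
    · rw [show x * (a * x ^ (2 * m + 1))⁻¹ = (a * x ^ (2 * m))⁻¹ by group]
      exact inv_mem (mul_mem ha (even_mem x m))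

end Subgroups

/-! ### The Steiner system on the projective line over eleven elements -/

section ProjectiveLine

variable {K : Type*} [Field K]

/-- The representative `(1, 0)` or `(x, 1)` of a point of the projective line in homogeneous
coordinates. -/
def homogeneous : OnePoint K → Fin 2 → K
  | ∞ => ![1, 0]
  | (x : K) => ![x, 1]

/-- The determinant of the homogeneous coordinates of two points of the projective line. -/
def bracket (p q : OnePoint K) : K :=
  homogeneous p 0 * homogeneous q 1 - homogeneous p 1 * homogeneous q 0

theorem bracket_eq_zero_iff {p q : OnePoint K} : bracket p q = 0 ↔ p = q := by
  induction p using OnePoint.rec <;> induction q using OnePoint.rec <;>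
    simp [bracket, homogeneous, sub_eq_zero]

variable [DecidableEq K]

theorem exists_mulVec_homogeneous (g : GL (Fin 2) K) (p : OnePoint K) :
    ∃ c : K, c ≠ 0 ∧ g.1.mulVec (homogeneous p) = c • homogeneous (g • p) := by
  have hdet : g 0 0 * g 1 1 - g 0 1 * g 1 0 ≠ 0 := by
    rw [← Matrix.det_fin_two]
    exact g.det_ne_zero
  induction p using OnePoint.rec with
  | infty =>
    rw [OnePoint.smul_infty_eq_ite]
    split_ifs with h
    · refine ⟨g 0 0, fun h0 => hdet (by rw [h, h0]; ring), ?_⟩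
      ext i
      fin_cases i <;> simp [homogeneous, Matrix.mulVec, dotProduct, h]
    · refine ⟨g 1 0, h, ?_⟩
      ext i
      fin_cases i <;> simp [homogeneous, Matrix.mulVec, dotProduct, mul_div_cancel₀ _ h]
  | coe x =>
    rw [OnePoint.smul_some_eq_ite]
    split_ifs with h
    · refine ⟨g 0 0 * x + g 0 1, fun h0 => hdet (by linear_combination g 0 0 * h - g 1 0 * h0), ?_⟩
      ext i
      fin_cases i <;> simp [homogeneous, Matrix.mulVec, dotProduct, h]
    · refine ⟨g 1 0 * x + g 1 1, h, ?_⟩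
      ext i
      fin_cases i <;> simp [homogeneous, Matrix.mulVec, dotProduct, mul_div_cancel₀ _ h]

theorem exists_bracket_smul (g : GL (Fin 2) K) : ∃ c : OnePoint K → K, (∀ p, c p ≠ 0) ∧
    ∀ p q, c p * c q * bracket (g • p) (g • q) = g.1.det * bracket p q := by
  choose c hc hg using exists_mulVec_homogeneous g
  refine ⟨c, hc, fun p q => ?_⟩
  have coordinate : ∀ p i, c p * homogeneous (g • p) i =
      g i 0 * homogeneous p 0 + g i 1 * homogeneous p 1 := fun p i => by
    simpa [Matrix.mulVec, dotProduct] using (congrFun (hg p) i).symm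
  calc c p * c q * bracket (g • p) (g • q)
      = c p * homogeneous (g • p) 0 * (c q * homogeneous (g • q) 1) -
          c p * homogeneous (g • p) 1 * (c q * homogeneous (g • q) 0) := by
        rw [bracket]; ring
    _ = g.1.det * bracket p q := by
        simp only [coordinate, bracket, Matrix.det_fin_two]; ring

theorem exists_specialLinear_smul_eq {r s : OnePoint K} (hrs : r ≠ s) :
    ∃ g : SL(2, K), (g : GL (Fin 2) K) • (∞ : OnePoint K) = r ∧
      (g : GL (Fin 2) K) • ((0 : K) : OnePoint K) = s := by
  have hb : bracket r s ≠ 0 := bracket_eq_zero_iff.not.2 hrs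
  let M : Matrix (Fin 2) (Fin 2) K := !![homogeneous r 0 * (bracket r s)⁻¹, homogeneous s 0;
    homogeneous r 1 * (bracket r s)⁻¹, homogeneous s 1]
  have hM : M.det = 1 := by
    rw [Matrix.det_fin_two_of, ← mul_inv_cancel₀ hb, bracket]
    ring
  let g : SL(2, K) := ⟨M, hM⟩
  have entry : ∀ i j, (g : GL (Fin 2) K) i j = M i j := fun _ _ => rfl
  refine ⟨g, ?_, ?_⟩
  · rw [OnePoint.smul_infty_eq_ite, entry, entry]
    induction r using OnePoint.rec <;> simp [M, homogeneous, hb]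
  · rw [OnePoint.smul_some_eq_ite, entry, entry, entry, entry]
    induction s using OnePoint.rec <;> simp [M, homogeneous]

end ProjectiveLine

instance {K : Type*} [DecidableEq K] : DecidableEq (OnePoint K) :=
  inferInstanceAs (DecidableEq (Option K))

/-- The hexad of `S(5,6,12)` attached to an ordered pair of points, with `hexad ∞ 0 = baseHexad`.
A fifth power in `ZMod 11` is `1` exactly for nonzero squares, and the square class of a product of
brackets in which every point occurs twice does not depend on homogeneous coordinates. -/
def hexad (r s : Points) : Set Points :=
  {p | p = r ∨ (bracket r p * bracket r s * bracket p s) ^ 5 = 1}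

instance (r s : Points) : DecidablePred (· ∈ hexad r s) := fun p =>
  inferInstanceAs (Decidable (p = r ∨ (bracket r p * bracket r s * bracket p s) ^ 5 = 1))

theorem smul_mem_hexad_iff (g : SL(2, ZMod 11)) {p r s : Points} :
    (g : GL (Fin 2) (ZMod 11)) • p ∈ hexad ((g : GL (Fin 2) (ZMod 11)) • r)
      ((g : GL (Fin 2) (ZMod 11)) • s) ↔ p ∈ hexad r s := by
  obtain ⟨c, hc, hbracket⟩ := exists_bracket_smul (g : GL (Fin 2) (ZMod 11))
  have hsl : ∀ p q, bracket p q = c p * c q * bracket ((g : GL (Fin 2) (ZMod 11)) • p)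
      ((g : GL (Fin 2) (ZMod 11)) • q) := fun p q => by
    rw [hbracket]; simp
  have fermat : (c r * c p * c s) ^ 10 = 1 :=
    ZMod.pow_card_sub_one_eq_one (mul_ne_zero (mul_ne_zero (hc r) (hc p)) (hc s))
  refine or_congr (MulAction.injective _).eq_iff ?_
  rw [hsl r p, hsl r s, hsl p s, ← mul_one (_ ^ 5), ← fermat]
  ring_nf

theorem hexad_infty_zero : hexad ∞ (0 : ZMod 11) = baseHexad := by
  ext p
  exact (by decide +kernel : ∀ p : Points, p ∈ hexad ∞ (0 : ZMod 11) ↔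
    p = ∞ ∨ p = (1 : ZMod 11) ∨ p = (3 : ZMod 11) ∨ p = (4 : ZMod 11) ∨ p = (5 : ZMod 11) ∨
      p = (9 : ZMod 11)) p

theorem image_smul_baseHexad (g : SL(2, ZMod 11)) :
    (fun p : Points => (g : GL (Fin 2) (ZMod 11)) • p) '' baseHexad =
      hexad ((g : GL (Fin 2) (ZMod 11)) • (∞ : Points))
        ((g : GL (Fin 2) (ZMod 11)) • ((0 : ZMod 11) : Points)) := by
  ext p
  rw [← hexad_infty_zero, Set.image_smul, Set.mem_smul_set_iff_inv_smul_mem, ← smul_mem_hexad_iff g,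
    smul_inv_smul]

theorem mem_hexads_iff {A : Set Points} : A ∈ hexads ↔ ∃ r s, r ≠ s ∧ hexad r s = A := by
  constructor
  · rintro ⟨g, rfl⟩
    exact ⟨_, _, (MulAction.injective _).ne (OnePoint.infty_ne_coe 0),
      (image_smul_baseHexad g).symm⟩
  · rintro ⟨r, s, hrs, rfl⟩
    obtain ⟨g, rfl, rfl⟩ := exists_specialLinear_smul_eq hrs
    exact ⟨g, image_smul_baseHexad g⟩

theorem mem_M12_iff {f : Equiv.Perm Points} : f ∈ M12 ↔
    ∀ r s, r ≠ s → ∃ r' s', r' ≠ s' ∧ ∀ p, p ∈ hexad r s ↔ f p ∈ hexad r' s' := by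
  have smul_eq : ∀ A B : Set Points, B = f • A ↔ ∀ p, p ∈ A ↔ f p ∈ B := fun A B => by
    rw [← inv_smul_eq_iff, Set.ext_iff]
    simp only [Set.mem_inv_smul_set_iff, Perm.smul_def, iff_comm]
  rw [M12, MulAction.mem_stabilizer_set_iff_smul_set_subset (Set.toFinite _)]
  constructor
  · intro hf r s hrs
    obtain ⟨r', s', hrs', h⟩ := mem_hexads_iff.1
      (hf (Set.smul_mem_smul_set (mem_hexads_iff.2 ⟨r, s, hrs, rfl⟩)))
    exact ⟨r', s', hrs', (smul_eq _ _).1 h⟩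
  · rintro hf _ ⟨_, hA, rfl⟩
    obtain ⟨r, s, hrs, rfl⟩ := mem_hexads_iff.1 hA
    obtain ⟨r', s', hrs', h⟩ := hf r s hrs
    exact mem_hexads_iff.2 ⟨r', s', hrs', (smul_eq _ _).2 h⟩

theorem hexad_inj_of_five_le_card {r s r' s' : Points} (hrs : r ≠ s) (hrs' : r' ≠ s')
    (h : 5 ≤ (Finset.univ.filter fun p => p ∈ hexad r s ∧ p ∈ hexad r' s').card) :
    r' = r ∧ s' = s := by
  have base : ∀ r s : Points, r ≠ s →
      5 ≤ (Finset.univ.filter fun p => p ∈ hexad ∞ (0 : ZMod 11) ∧ p ∈ hexad r s).card →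
        r = ∞ ∧ s = (0 : ZMod 11) := by
    decide +kernel
  obtain ⟨g, rfl, rfl⟩ := exists_specialLinear_smul_eq hrs
  have surjective := MulAction.surjective (β := Points) (g : GL (Fin 2) (ZMod 11))
  obtain ⟨r', rfl⟩ := surjective r'
  obtain ⟨s', rfl⟩ := surjective s'
  have card_eq : (Finset.univ.filter fun p => p ∈ hexad ∞ (0 : ZMod 11) ∧ p ∈ hexad r' s').card =
      (Finset.univ.filter fun p => p ∈ hexad ((g : GL (Fin 2) (ZMod 11)) • (∞ : Points))
        ((g : GL (Fin 2) (ZMod 11)) • ((0 : ZMod 11) : Points)) ∧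
          p ∈ hexad ((g : GL (Fin 2) (ZMod 11)) • r') ((g : GL (Fin 2) (ZMod 11)) • s')).card :=
    Finset.card_equiv (MulAction.toPerm (g : GL (Fin 2) (ZMod 11))) fun p => by
      simp only [Finset.mem_filter, Finset.mem_univ, true_and, MulAction.toPerm_apply,
        smul_mem_hexad_iff]
  obtain ⟨hr, hs⟩ := base r' s' (fun h => hrs' (congrArg _ h)) (card_eq ▸ h)
  exact ⟨congrArg _ hr, congrArg _ hs⟩

theorem card_hexad : ∀ r s : Points, r ≠ s →
    (Finset.univ.filter fun p => p ∈ hexad r s).card = 6 := by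
  decide +kernel

/-- The hexad `hexad r s` meets `hexad ∞ (-1)` in four points. -/
def MeetsInFour (r s : Points) : Prop :=
  r ≠ s ∧ (Finset.univ.filter fun p => p ∈ hexad ∞ (-1 : ZMod 11) ∧ p ∈ hexad r s).card = 4

instance (r s : Points) : Decidable (MeetsInFour r s) :=
  inferInstanceAs (Decidable (_ ∧ _))

/-- The hexads `hexad r s` and `hexad r' s'` meet `hexad ∞ (-1)` in the same points. -/
def SameTrace (r s r' s' : Points) : Prop :=
  r' ≠ s' ∧ ∀ p, p ∈ hexad ∞ (-1 : ZMod 11) → (p ∈ hexad r s ↔ p ∈ hexad r' s')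

instance (r s r' s' : Points) : Decidable (SameTrace r s r' s') :=
  inferInstanceAs (Decidable (_ ∧ _))

/-- Two hexads with the same four points in `hexad ∞ (-1)` have `p, x` respectively `v, y` as their
remaining points. An element of `M12` that fixes `hexad ∞ (-1)` pointwise and sends `p` to `v` then
maps the first hexad to the second, which forces it to send `x` to `y`. -/
def PairTransfer (p x v y : Points) : Prop :=
  (x ∉ hexad ∞ (-1 : ZMod 11) ∧ x ≠ p ∧ v ∉ hexad ∞ (-1 : ZMod 11) ∧
    y ∉ hexad ∞ (-1 : ZMod 11) ∧ y ≠ v) ∧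
  ∃ r s, p ∈ hexad r s ∧ x ∈ hexad r s ∧ MeetsInFour r s ∧
    ∃ r' s', v ∈ hexad r' s' ∧ y ∈ hexad r' s' ∧ SameTrace r s r' s'

instance (p x v y : Points) : Decidable (PairTransfer p x v y) :=
  inferInstanceAs (Decidable (_ ∧ ∃ _, _))

theorem apply_mem_hexad_iff_of_sameTrace {r s r' s' p : Points} (hA : MeetsInFour r s)
    (hAB : SameTrace r s r' s') {f : Perm Points} (hf : f ∈ M12)
    (hfix : ∀ q ∈ hexad ∞ (-1 : ZMod 11), f q = q) (hp : p ∈ hexad r s) (hfp : f p ∈ hexad r' s')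
    (hv : f p ∉ hexad ∞ (-1 : ZMod 11)) (q : Points) : f q ∈ hexad r' s' ↔ q ∈ hexad r s := by
  obtain ⟨hrs, hfour⟩ := hA
  obtain ⟨hrs', htrace⟩ := hAB
  obtain ⟨r'', s'', hrs'', himage⟩ := mem_M12_iff.1 hf r s hrs
  have card_five := Finset.card_insert_of_notMem
    (s := Finset.univ.filter fun q => q ∈ hexad ∞ (-1 : ZMod 11) ∧ q ∈ hexad r s)
    fun h => hv (Finset.mem_filter.1 h).2.1
  rw [hfour] at card_five
  obtain ⟨rfl, rfl⟩ := hexad_inj_of_five_le_card hrs' hrs'' <| card_five.ge.trans <|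
    Finset.card_le_card fun q hq => by
      refine Finset.mem_filter.2 ⟨Finset.mem_univ q, ?_⟩
      rcases Finset.mem_insert.1 hq with rfl | hq
      · exact ⟨hfp, (himage p).1 hp⟩
      · obtain ⟨-, hqH, hqA⟩ := Finset.mem_filter.1 hq
        exact ⟨(htrace q hqH).1 hqA, hfix q hqH ▸ (himage q).1 hqA⟩
  exact (himage q).symm

theorem PairTransfer.apply_eq {p x v y : Points} (h : PairTransfer p x v y) {f : Perm Points}
    (hf : f ∈ M12) (hfix : ∀ q ∈ hexad ∞ (-1 : ZMod 11), f q = q) (hfp : f p = v) : f x = y := by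
  subst hfp
  obtain ⟨⟨hx, hxp, hv, hy, hyv⟩, r, s, hpA, hxA, hA, r', s', hvB, hyB, hAB⟩ := h
  have hfxB := (apply_mem_hexad_iff_of_sameTrace hA hAB hf hfix hpA hvB hv x).2 hxA
  obtain ⟨-, hfour⟩ := hA
  obtain ⟨hrs', htrace⟩ := hAB
  have hfx : f x ∉ hexad ∞ (-1 : ZMod 11) := fun h => hx (f.injective (hfix _ h) ▸ h)
  have hfxv : f x ≠ f p := f.injective.ne hxp
  by_contra hne
  have disjoint : Disjoint
      (Finset.univ.filter fun q => q ∈ hexad ∞ (-1 : ZMod 11) ∧ q ∈ hexad r s) {f x, f p, y} := by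
    simp only [Finset.disjoint_insert_right, Finset.disjoint_singleton_right, Finset.mem_filter,
      hfx, hv, hy, false_and, and_false, not_false_eq_true, and_self]
  have subset : (Finset.univ.filter fun q => q ∈ hexad ∞ (-1 : ZMod 11) ∧ q ∈ hexad r s) ∪
      {f x, f p, y} ⊆ Finset.univ.filter fun q => q ∈ hexad r' s' := by
    intro q hq
    simp only [Finset.mem_union, Finset.mem_filter, Finset.mem_univ, true_and, Finset.mem_insert,
      Finset.mem_singleton] at hq ⊢
    rcases hq with hq | rfl | rfl | rfl
    exacts [(htrace q hq.1).1 hq.2, hfxB, hvB, hyB]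
  have card_three : ({f x, f p, y} : Finset Points).card = 3 :=
    Finset.card_eq_three.2 ⟨_, _, _, hfxv, hne, hyv.symm, rfl⟩
  have := Finset.card_le_card subset
  rw [Finset.card_union_of_disjoint disjoint, hfour, card_three, card_hexad _ _ hrs'] at this
  omega

theorem exists_pairTransfer : ∀ p, p ∉ hexad ∞ (-1 : ZMod 11) → ∀ v, v ∉ hexad ∞ (-1 : ZMod 11) →
    v ≠ p → ∃ x y, PairTransfer p x v y ∧ ∃ y', y' ≠ y ∧ PairTransfer p x v y' := by
  decide +kernel

theorem eq_one_of_forall_mem_hexad {f : Perm Points} (hf : f ∈ M12)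
    (hfix : ∀ q ∈ hexad ∞ (-1 : ZMod 11), f q = q) : f = 1 := by
  ext p : 1
  by_cases hp : p ∈ hexad ∞ (-1 : ZMod 11)
  · exact hfix p hp
  by_contra hne
  have hfp : f p ∉ hexad ∞ (-1 : ZMod 11) := fun h => hp (f.injective (hfix _ h) ▸ h)
  obtain ⟨x, y, hy, y', hne', hy'⟩ := exists_pairTransfer p hp (f p) hfp hne
  exact hne' ((hy'.apply_eq hf hfix rfl).symm.trans (hy.apply_eq hf hfix rfl))

theorem mem_M10_iff {f : Perm Points} :
    f ∈ M10 ↔ f ∈ M12 ∧ f ∞ = ∞ ∧ f (0 : ZMod 11) = (0 : ZMod 11) := by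
  simp only [M10, Subgroup.mem_inf, mem_fixingSubgroup_iff, Set.mem_insert_iff,
    Set.mem_singleton_iff, forall_eq_or_imp, forall_eq, Perm.smul_def]

theorem eq_one_of_mem_M10 {f : Perm Points} (hf : f ∈ M10) (h2 : f (2 : ZMod 11) = (2 : ZMod 11))
    (h3 : f (3 : ZMod 11) = (3 : ZMod 11)) (h4 : f (4 : ZMod 11) = (4 : ZMod 11)) : f = 1 := by
  let five : Finset Points := {∞, ((0 : ZMod 11) : Points), ((2 : ZMod 11) : Points),
    ((3 : ZMod 11) : Points), ((4 : ZMod 11) : Points)}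
  have mem_hexad : ∀ q : Points, q ∈ hexad ∞ (-1 : ZMod 11) ↔ q ∈ five ∨ q = (8 : ZMod 11) := by
    decide +kernel
  obtain ⟨hM12, hinf, hzero⟩ := mem_M10_iff.1 hf
  have hfix : ∀ q ∈ five, f q = q := by
    simp only [five, Finset.mem_insert, Finset.mem_singleton, forall_eq_or_imp, forall_eq, hinf,
      hzero, h2, h3, h4, and_self]
  obtain ⟨r, s, hrs, himage⟩ := mem_M12_iff.1 hM12 ∞ (-1 : ZMod 11) (OnePoint.infty_ne_coe _)
  have five_le_card :
      five.card ≤ (Finset.univ.filter fun q => q ∈ hexad ∞ (-1 : ZMod 11) ∧ q ∈ hexad r s).card :=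
    Finset.card_le_card fun q hq => by
      have hqH := (mem_hexad q).2 (Or.inl hq)
      exact Finset.mem_filter.2 ⟨Finset.mem_univ q, hqH, hfix q hq ▸ (himage q).1 hqH⟩
  obtain ⟨rfl, rfl⟩ := hexad_inj_of_five_le_card (OnePoint.infty_ne_coe _) hrs five_le_card
  refine eq_one_of_forall_mem_hexad hM12 fun q hq => ?_
  rcases (mem_hexad q).1 hq with h | rfl
  · exact hfix q h
  rcases (mem_hexad _).1 ((himage _).1 hq) with h | h
  · exact f.injective (hfix _ h)
  · exact h

theorem card_M10_le : Nat.card M10 ≤ 720 := by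
  let T : Finset Points := {∞, ((0 : ZMod 11) : Points)}ᶜ
  let s : Fin 3 ↪ Points := ⟨fun i => (![2, 3, 4] i : ZMod 11), by decide +kernel⟩
  refine card_le_descFactorial (Y := Points) T (fun f y hy => ?_) s (by decide +kernel)
    fun f hf => Subtype.ext (eq_one_of_mem_M10 f.2 (hf 0) (hf 1) (hf 2))
  obtain ⟨-, hinf, hzero⟩ := mem_M10_iff.1 f.2
  simp only [T, Finset.mem_compl, Finset.mem_insert, Finset.mem_singleton, not_or] at hy ⊢
  exact ⟨fun h => hy.1 (f.1.injective (h.trans hinf.symm)),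
    fun h => hy.2 (f.1.injective (h.trans hzero.symm))⟩

/-- The permutation `x ↦ 4 x` of the projective line, an element of order five of `M10`. -/
def permFive : Perm Points :=
  Equiv.optionCongr (c[(1 : ZMod 11), 4, 5, 9, 3] * c[(2 : ZMod 11), 8, 10, 7, 6])

/-- An element of order eight of `M10`. -/
def permEight : Perm Points :=
  Equiv.optionCongr (c[(1 : ZMod 11), 4] * c[(2 : ZMod 11), 5, 9, 7, 10, 6, 8, 3])

theorem permFive_mem_M10 : permFive ∈ M10 :=
  mem_M10_iff.2 ⟨mem_M12_iff.2 fun r s hrs => ⟨permFive r, permFive s, permFive.injective.ne hrs,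
    (by decide +kernel : ∀ r s p : Points,
      p ∈ hexad r s ↔ permFive p ∈ hexad (permFive r) (permFive s)) r s⟩, rfl, by decide +kernel⟩

theorem permEight_mem_M10 : permEight ∈ M10 :=
  mem_M10_iff.2 ⟨mem_M12_iff.2 (by decide +kernel), rfl, by decide +kernel⟩

theorem orderOf_permEight : orderOf permEight = 8 :=
  orderOf_eq_prime_pow (p := 2) (n := 2) (by decide +kernel) (by decide +kernel)

theorem orderOf_permFive_mul_permEight : orderOf (permFive * permEight) = 4 :=
  orderOf_eq_prime_pow (p := 2) (n := 1) (by decide +kernel) (by decide +kernel)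

/-- The bisection `{s, sᶜ}` of the six points attached to a nonzero element of `ZMod 11`, and
`{univ, ∅}` and `∅` for the two points fixed by `M10`: the points permuted by `M10`, as objects on
which `A6` acts. -/
def pointLabel : Points → Finset (Finset (Fin 6))
  | ∞ => ∅
  | (x : ZMod 11) =>
    let s : Finset (Fin 6) := (![Finset.univ, {0, 2, 5}, {0, 1, 5}, {1, 4, 5}, {1, 3, 5}, {2, 4, 5},
      {0, 4, 5}, {3, 4, 5}, {1, 2, 5}, {0, 3, 5}, {2, 3, 5}] : Fin 11 → _) x
    {s, sᶜ}

theorem pointLabel_injective : Function.Injective pointLabel := by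
  unfold Function.Injective
  decide +kernel

theorem genA_smul_pointLabel : ∀ p, genA • pointLabel p = pointLabel (permFive p) := by
  decide +kernel

theorem genB_smul_pointLabel :
    ∀ p, genB • pointLabel p = pointLabel ((permEight * permFive ^ 2 * permEight) p) := by
  decide +kernel

/-- `permEight` as an element of `M10`. -/
def m10Eight : M10 := ⟨permEight, permEight_mem_M10⟩

theorem orderOf_m10Eight : orderOf m10Eight = 8 :=
  (Subgroup.orderOf_coe m10Eight).symm.trans orderOf_permEight

theorem exists_injective_M10 : ∃ ι : A6 →* M10, Function.Injective ι ∧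
    ∃ w, orderOf w = 4 ∧ w ∉ ι.range := by
  let five : M10 := ⟨permFive, permFive_mem_M10⟩
  obtain ⟨ι, hι⟩ :=
    exists_hom_of_equivariant pointLabel_injective closure_genA_genB (X := M10) <| by
      rintro _ (rfl | rfl)
      · exact ⟨five, genA_smul_pointLabel⟩
      · exact ⟨m10Eight * five ^ 2 * m10Eight, genB_smul_pointLabel⟩
  have map_genA : ι genA = five := by
    ext z : 2
    exact pointLabel_injective ((hι genA z).trans (genA_smul_pointLabel z))
  have injective : Function.Injective ι := injective_of_map_ne_one (a := genA) <| by
    rw [map_genA]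
    exact fun h => (by decide +kernel : permFive ≠ 1) (congrArg Subtype.val h)
  refine ⟨ι, injective, five * m10Eight,
    (Subgroup.orderOf_coe _).symm.trans orderOf_permFive_mul_permEight, fun h => ?_⟩
  refine notMem_range_of_orderOf_ne injective (fun a => ?_)
    ((mul_mem_cancel_left (MonoidHom.mem_range.2 ⟨genA, map_genA⟩)).1 h)
  rw [orderOf_m10Eight]
  exact orderOf_A6_ne_eight a

/-! ### The projective general linear group over nine elements -/

section ProjGenLin

variable {K : Type*} [Field K]

theorem mk_eq_one_iff (g : GL (Fin 2) K) :
    (Matrix.ProjGenLinGroup.mk g : PGL(2, K)) = 1 ↔ g 0 1 = 0 ∧ g 1 0 = 0 ∧ g 0 0 = g 1 1 := by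
  rw [Matrix.ProjGenLinGroup.mk_eq_one,
    Matrix.GeneralLinearGroup.mem_center_iff_val_mem_range_scalar]
  constructor
  · rintro ⟨s, hs⟩
    simp [← hs]
  · rintro ⟨h01, h10, h00⟩
    refine ⟨g 0 0, ?_⟩
    ext i j
    fin_cases i <;> fin_cases j <;> simp [h01, h10, h00]

theorem mk_sq_eq_one_iff (g : GL (Fin 2) K) : (Matrix.ProjGenLinGroup.mk (g ^ 2) : PGL(2, K)) = 1 ↔
    g.1.trace = 0 ∨ (Matrix.ProjGenLinGroup.mk g : PGL(2, K)) = 1 := by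
  have off_diagonal : (g ^ 2) 0 1 = g.1.trace * g 0 1 ∧ (g ^ 2) 1 0 = g.1.trace * g 1 0 ∧
      (g ^ 2) 0 0 - (g ^ 2) 1 1 = g.1.trace * (g 0 0 - g 1 1) := by
    rw [sq, Units.val_mul]
    simp only [Matrix.mul_apply, Fin.sum_univ_two, Matrix.trace_fin_two]
    refine ⟨?_, ?_, ?_⟩ <;> ring
  rw [mk_eq_one_iff, mk_eq_one_iff, ← sub_eq_zero (a := (g ^ 2) 0 0), off_diagonal.1,
    off_diagonal.2.1, off_diagonal.2.2]
  simp only [mul_eq_zero, sub_eq_zero]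
  tauto

theorem trace_sq_eq (g : GL (Fin 2) K) :
    (g ^ 2).1.trace = g.1.trace ^ 2 - 2 * g.1.det := by
  rw [sq g, Units.val_mul]
  simp only [Matrix.mul_apply, Fin.sum_univ_two, Matrix.trace_fin_two, Matrix.det_fin_two]
  ring

theorem trace_sq_eq_two_mul_det {g : GL (Fin 2) K}
    (hg : orderOf (Matrix.ProjGenLinGroup.mk g : PGL(2, K)) = 4) :
    g.1.trace ^ 2 = 2 * g.1.det := by
  have sq_ne_one : (Matrix.ProjGenLinGroup.mk (g ^ 2) : PGL(2, K)) ≠ 1 := by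
    rw [map_pow]
    exact pow_ne_one_of_lt_orderOf two_ne_zero (hg ▸ by norm_num)
  have pow_four : (Matrix.ProjGenLinGroup.mk ((g ^ 2) ^ 2) : PGL(2, K)) = 1 := by
    rw [← pow_mul, map_pow]
    exact orderOf_dvd_iff_pow_eq_one.1 hg.dvd
  rw [← sub_eq_zero, ← trace_sq_eq]
  exact ((mk_sq_eq_one_iff _).1 pow_four).resolve_right sq_ne_one

variable [DecidableEq K]

theorem smul_eq_of_mulVec_homogeneous {g : GL (Fin 2) K} {p q : OnePoint K}
    (h : g.1.mulVec (homogeneous p) 0 * homogeneous q 1 =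
      g.1.mulVec (homogeneous p) 1 * homogeneous q 0) : g • p = q := by
  obtain ⟨c, hc, hg⟩ := exists_mulVec_homogeneous g p
  rw [hg, Pi.smul_apply, Pi.smul_apply, smul_mul_assoc, smul_mul_assoc] at h
  exact bracket_eq_zero_iff.1 (sub_eq_zero.2 (smul_right_injective K hc h))

theorem mk_eq_one_of_three_fixed {g : GL (Fin 2) K} (hinf : g • (∞ : OnePoint K) = ∞)
    (hzero : g • ((0 : K) : OnePoint K) = (0 : K)) (hone : g • ((1 : K) : OnePoint K) = (1 : K)) :
    (Matrix.ProjGenLinGroup.mk g : PGL(2, K)) = 1 := by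
  obtain ⟨a, -, ha⟩ := exists_mulVec_homogeneous g ∞
  obtain ⟨b, -, hb⟩ := exists_mulVec_homogeneous g (0 : K)
  obtain ⟨c, -, hc⟩ := exists_mulVec_homogeneous g (1 : K)
  simp only [hinf, hzero, hone, homogeneous, Matrix.mulVec_fin_two, Matrix.smul_cons,
    Matrix.smul_empty, smul_eq_mul, mul_one, mul_zero, add_zero, zero_add, funext_iff,
    Fin.forall_fin_two, Matrix.cons_val_zero, Matrix.cons_val_one, Matrix.cons_val_fin_one]
    at ha hb hc
  rw [mk_eq_one_iff]
  refine ⟨hb.1, ha.2, ?_⟩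
  rw [hb.1, add_zero] at hc
  rw [ha.2, zero_add] at hc
  rw [hc.1, hc.2]

/-- The action by Möbius transformations. -/
instance : MulAction PGL(2, K) (OnePoint K) :=
  Matrix.ProjGenLinGroup.mulActionOfGL fun u p => smul_eq_of_mulVec_homogeneous (by
    change (Matrix.scalar (Fin 2) u.1).mulVec _ 0 * _ = (Matrix.scalar (Fin 2) u.1).mulVec _ 1 * _
    rw [Matrix.scalar_apply, Matrix.mulVec_diagonal, Matrix.mulVec_diagonal]
    ring)

theorem mk_smul (g : GL (Fin 2) K) (p : OnePoint K) :
    (Matrix.ProjGenLinGroup.mk g : PGL(2, K)) • p = g • p := rfl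

theorem eq_one_of_three_fixed {x : PGL(2, K)} (hinf : x • (∞ : OnePoint K) = ∞)
    (hzero : x • ((0 : K) : OnePoint K) = (0 : K)) (hone : x • ((1 : K) : OnePoint K) = (1 : K)) :
    x = 1 := by
  obtain ⟨g, rfl⟩ := Matrix.ProjGenLinGroup.mk_surjective x
  exact mk_eq_one_of_three_fixed hinf hzero hone

instance : FaithfulSMul PGL(2, K) (OnePoint K) :=
  faithfulSMul_iff.2 fun _ h => eq_one_of_three_fixed (h _) (h _) (h _)

end ProjGenLin

/-- The field with nine elements. -/
abbrev F9 : Type := QuadraticAlgebra (ZMod 3) 2 0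

instance fact_F9 : Fact (∀ r : ZMod 3, r ^ 2 ≠ 2 + 0 * r) := ⟨by decide⟩

instance fintype_F9 : Fintype F9 := Fintype.ofEquiv _ (QuadraticAlgebra.equivProd 2 0).symm

theorem card_F9 : Fintype.card F9 = 9 := by decide +kernel

theorem card_PGL_F9_le : Nat.card PGL(2, F9) ≤ 720 := by
  let s : Fin 3 ↪ OnePoint F9 :=
    ⟨![∞, ((0 : F9) : OnePoint F9), ((1 : F9) : OnePoint F9)], by decide +kernel⟩
  exact card_le_descFactorial Finset.univ (fun _ _ _ => Finset.mem_univ _) s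
    (fun _ => Finset.mem_univ _) fun x hx => eq_one_of_three_fixed (hx 0) (hx 1) (hx 2)

/-- Labels for the points of the projective line by bisections of the six points. -/
def lineLabel (p : OnePoint F9) : Finset (Finset (Fin 6)) :=
  let s : Finset (Fin 6) := p.elim {0, 1, 5} fun k =>
    (![![{1, 2, 5}, {0, 2, 5}, {3, 4, 5}], ![{1, 4, 5}, {0, 4, 5}, {2, 3, 5}],
      ![{1, 3, 5}, {0, 3, 5}, {2, 4, 5}]] : Fin 3 → Fin 3 → _) k.im k.re
  {s, sᶜ}

theorem lineLabel_injective : Function.Injective lineLabel := by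
  unfold Function.Injective
  decide +kernel

/-- The matrix by which `genA` acts on the projective line. -/
def lineA : GL (Fin 2) F9 := .mkOfDetNeZero !![0, 1; 2, ⟨1, 1⟩] (by
  rw [Matrix.det_fin_two_of]; decide +kernel)

/-- The matrix by which `genB` acts on the projective line. -/
def lineB : GL (Fin 2) F9 := .mkOfDetNeZero !![1, 1; 0, 1] (by
  rw [Matrix.det_fin_two_of]; decide +kernel)

theorem genA_smul_lineLabel (p : OnePoint F9) : genA • lineLabel p = lineLabel (lineA • p) := by
  have table : ∀ p : OnePoint F9, ∃ q, genA • lineLabel p = lineLabel q ∧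
      lineA.1.mulVec (homogeneous p) 0 * homogeneous q 1 =
        lineA.1.mulVec (homogeneous p) 1 * homogeneous q 0 := by
    decide +kernel
  obtain ⟨q, hq, hsmul⟩ := table p
  rw [hq, smul_eq_of_mulVec_homogeneous hsmul]

theorem genB_smul_lineLabel (p : OnePoint F9) : genB • lineLabel p = lineLabel (lineB • p) := by
  have table : ∀ p : OnePoint F9, ∃ q, genB • lineLabel p = lineLabel q ∧
      lineB.1.mulVec (homogeneous p) 0 * homogeneous q 1 =
        lineB.1.mulVec (homogeneous p) 1 * homogeneous q 0 := by
    decide +kernel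
  obtain ⟨q, hq, hsmul⟩ := table p
  rw [hq, smul_eq_of_mulVec_homogeneous hsmul]

/-- A matrix whose class has order 8. -/
def glEight : GL (Fin 2) F9 := .mkOfDetNeZero !![⟨1, 1⟩, 0; 0, 1] (by
  rw [Matrix.det_fin_two_of]; decide +kernel)

/-- A matrix whose class has order 10. -/
def glTen : GL (Fin 2) F9 := .mkOfDetNeZero !![0, 1; ⟨1, 1⟩, 1] (by
  rw [Matrix.det_fin_two_of]; decide +kernel)

theorem orderOf_mk_glEight : orderOf (Matrix.ProjGenLinGroup.mk glEight : PGL(2, F9)) = 8 := by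
  refine orderOf_eq_prime_pow (p := 2) (n := 2) ?_ ?_ <;>
  · rw [← map_pow, mk_eq_one_iff, Units.val_pow_eq_pow_val]
    decide +kernel

theorem orderOf_mk_glTen : orderOf (Matrix.ProjGenLinGroup.mk glTen : PGL(2, F9)) = 10 := by
  refine orderOf_eq_of_pow_and_pow_div_prime (by norm_num) ?_ fun p hp hd => ?_
  · rw [← map_pow, mk_eq_one_iff, Units.val_pow_eq_pow_val]
    decide +kernel
  · have hp : p ∈ Nat.primeFactors 10 := Nat.mem_primeFactors.2 ⟨hp, hd, by norm_num⟩
    rw [show Nat.primeFactors 10 = {2, 5} by decide +kernel, Finset.mem_insert,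
      Finset.mem_singleton] at hp
    rcases hp with rfl | rfl <;>
    · rw [ne_eq, ← map_pow, mk_eq_one_iff, Units.val_pow_eq_pow_val]
      decide +kernel

/-- The fourth power of the determinant. On scalar matrices it is an eighth power, so it descends
from `GL` to `PGL`; it is the quadratic character of the determinant. -/
def detPowFour : PGL(2, F9) →* F9ˣ :=
  Matrix.ProjGenLinGroup.lift ((powMonoidHom 4).comp Matrix.GeneralLinearGroup.det) <| by
    ext u : 1
    have card_units : Fintype.card F9ˣ = 8 := by rw [Fintype.card_units, card_F9]
    rw [MonoidHom.comp_apply, MonoidHom.comp_apply, MonoidHom.one_apply, powMonoidHom_apply,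
      show Matrix.GeneralLinearGroup.det (Matrix.GeneralLinearGroup.scalar (Fin 2) u) = u ^ 2 by
        ext1; simp, ← pow_mul]
    exact (congrArg (u ^ ·) card_units).symm.trans pow_card_eq_one

theorem detPowFour_eq_one_of_orderOf_eq_four {x : PGL(2, F9)} (hx : orderOf x = 4) :
    detPowFour x = 1 := by
  obtain ⟨g, rfl⟩ := Matrix.ProjGenLinGroup.mk_surjective x
  have square_det := trace_sq_eq_two_mul_det hx
  have char_three : (3 : F9) = 0 := by decide +kernel
  have det_eq : g.1.det = -g.1.trace ^ 2 := by linear_combination char_three * g.1.det + square_det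
  have trace_ne_zero : g.1.trace ≠ 0 := fun h => by
    have := (Matrix.GeneralLinearGroup.det g).ne_zero
    simp [det_eq, h] at this
  have := FiniteField.pow_card_sub_one_eq_one _ trace_ne_zero
  rw [card_F9] at this
  ext1
  change g.1.det ^ 4 = 1
  rw [det_eq, Even.neg_pow (by decide), ← pow_mul]
  exact this

theorem nonempty_PGL_equiv {K L : Type*} [Field K] [Field L] (e : K ≃+* L) :
    Nonempty (PGL(2, K) ≃* PGL(2, L)) :=
  ⟨(Matrix.ProjGenLinGroup.map e.toRingHom).toMulEquiv
    (Matrix.ProjGenLinGroup.map e.symm.toRingHom)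
    (by rw [← Matrix.ProjGenLinGroup.map_comp]; simp [Matrix.ProjGenLinGroup.map_id])
    (by rw [← Matrix.ProjGenLinGroup.map_comp]; simp [Matrix.ProjGenLinGroup.map_id])⟩

theorem nonempty_PGL_F9_equiv : Nonempty (PGL(2, F9) ≃* PGL(2, GaloisField 3 2)) := by
  have fintype : Fintype (GaloisField 3 2) := Fintype.ofFinite _
  refine nonempty_PGL_equiv (FiniteField.ringEquivOfCardEq ?_)
  rw [card_F9, ← Nat.card_eq_fintype_card, GaloisField.card 3 2 two_ne_zero]
  rfl

instance finite_PGL_F9 : Finite PGL(2, F9) :=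
  Finite.of_surjective _ Matrix.ProjGenLinGroup.mk_surjective

theorem exists_injective_PGL : ∃ ι : A6 →* PGL(2, F9), Function.Injective ι ∧
    ∀ x, orderOf x = 4 → x ∈ ι.range := by
  obtain ⟨ι, hι⟩ :=
    exists_hom_of_equivariant lineLabel_injective closure_genA_genB (X := PGL(2, F9)) <| by
      rintro _ (rfl | rfl)
      · exact ⟨.mk lineA, genA_smul_lineLabel⟩
      · exact ⟨.mk lineB, genB_smul_lineLabel⟩
  have injective : Function.Injective ι := injective_of_map_ne_one (a := genA) fun h => by
    have fixed := hι genA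
    simp only [h, one_smul] at fixed
    exact (by decide +kernel : ¬ ∀ p, lineLabel p = genA • lineLabel p) fixed
  have range_le : ι.range ≤ detPowFour.ker := by
    rw [MonoidHom.range_le_ker_iff, ← MonoidHom.range_eq_bot_iff, eq_bot_iff]
    exact range_le_of_commutator_le (commutator_eq_bot _).le _
  have glEight_notMem := notMem_range_of_orderOf_ne injective fun a =>
    orderOf_mk_glEight.symm ▸ orderOf_A6_ne_eight a
  have index_range := index_range_eq_two (card_A6 ▸ card_PGL_F9_le) injective glEight_notMem
  refine ⟨ι, injective, fun x hx => by_contra fun hxr => ?_⟩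
  have mul_mem_ker := range_le <|
    (Subgroup.mul_mem_iff_of_index_two index_range).2 (iff_of_false hxr glEight_notMem)
  rw [MonoidHom.mem_ker, map_mul, detPowFour_eq_one_of_orderOf_eq_four hx, one_mul] at mul_mem_ker
  exact (by decide +kernel : glEight.1.det ^ 4 ≠ 1) (congrArg Units.val mul_mem_ker)

/-! ### Subgroups of the automorphism group of `A6` -/

theorem conj_A6_injective : Function.Injective (MulAut.conj : A6 →* MulAut A6) :=
  conj_injective center_A6

theorem card_le_two_mul_card_A6 {n : ℕ} (hn : n ≤ 720) : n ≤ 2 * Nat.card A6 := by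
  rwa [card_A6]

theorem card_M10 : Nat.card M10 = 720 := by
  obtain ⟨ι, hι, w, -, hw⟩ := exists_injective_M10
  rw [card_eq_two_mul (card_le_two_mul_card_A6 card_M10_le) hι hw, card_A6]

theorem card_PGL_F9 : Nat.card PGL(2, F9) = 720 := by
  obtain ⟨ι, hι, -⟩ := exists_injective_PGL
  rw [card_eq_two_mul (card_le_two_mul_card_A6 card_PGL_F9_le) hι (u := .mk glEight), card_A6]
  exact notMem_range_of_orderOf_ne hι fun a => orderOf_mk_glEight ▸ orderOf_A6_ne_eight a

theorem card_perm_six : Nat.card (Perm (Fin 6)) = 720 := by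
  rw [Nat.card_perm, Nat.card_eq_fintype_card, Fintype.card_fin]
  rfl

theorem exists_injective_mulAut_M10 : ∃ c : M10 →* MulAut A6, Function.Injective c := by
  obtain ⟨ι, hι, -⟩ := exists_injective_M10
  obtain ⟨c, hc, -⟩ := exists_injective_mulAut (n := 1) center_A6
    (card_le_two_mul_card_A6 card_M10_le) hι orderOf_m10Eight orderOf_A6_ne_eight
  exact ⟨c, hc⟩

theorem exists_injective_mulAut_PGL : ∃ c : PGL(2, F9) →* MulAut A6, Function.Injective c := by
  obtain ⟨ι, hι, -⟩ := exists_injective_PGL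
  obtain ⟨c, hc, -⟩ := exists_injective_mulAut (n := 1) center_A6
    (card_le_two_mul_card_A6 card_PGL_F9_le) hι orderOf_mk_glEight orderOf_A6_ne_eight
  exact ⟨c, hc⟩

theorem index_range_symAut : symAut.range.index = 2 := by
  obtain ⟨c, hc⟩ := exists_injective_mulAut_M10
  refine Subgroup.index_eq_two_iff_exists_notMem_and.2 ⟨(c m10Eight)⁻¹, ?_, fun φ => ?_⟩ <;>
    have notMem : c m10Eight ∉ symAut.range := by
      refine notMem_range_of_orderOf_ne symAut_injective fun σ => ?_
      rw [orderOf_injective c hc, orderOf_m10Eight]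
      exact orderOf_ne_eight σ
  · rwa [inv_mem_iff]
  · exact or_iff_not_imp_right.2 fun hφ => mul_inv_mem_range_symAut hφ notMem

theorem card_mulAut_A6 : Nat.card (MulAut A6) = 1440 := by
  rw [← symAut.range.index_mul_card, index_range_symAut,
    ← Nat.card_congr (MonoidHom.ofInjective symAut_injective).toEquiv, card_perm_six]

theorem card_range_of_injective {X : Type*} [Group X] {f : A6 →* X} (hf : Function.Injective f) :
    Nat.card f.range = 360 :=
  (Nat.card_congr (MonoidHom.ofInjective hf).toEquiv).symm.trans card_A6

theorem index_inn : inn.index = 4 := by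
  have card_mul_index := inn.card_mul_index
  rw [inn, card_range_of_injective conj_A6_injective, card_mulAut_A6] at card_mul_index
  rw [inn]
  omega

instance normal_inn : inn.Normal where
  conj_mem := by
    rintro _ ⟨a, rfl⟩ φ
    refine ⟨φ a, ?_⟩
    ext1 b
    simp only [MulAut.conj_apply, MulAut.mul_apply, map_mul, map_inv, MulAut.apply_inv_self]

theorem range_eq_inn {f : A6 →* MulAut A6} (hf : Function.Injective f) : f.range = inn :=
  Subgroup.eq_of_le_of_card_ge
    (range_le_of_commutator_le (commutator_le_of_index_eq_four index_inn) f)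
    ((card_range_of_injective conj_A6_injective).trans (card_range_of_injective hf).symm).le

theorem coe_symm_mem_inn_iff {X : Type*} [Group X] {N : Subgroup (MulAut A6)} (e : N ≃* X)
    {ι : A6 →* X} (hι : Function.Injective ι) (x : X) :
    (e.symm x : MulAut A6) ∈ inn ↔ x ∈ ι.range := by
  let f : A6 →* MulAut A6 := N.subtype.comp (e.symm.toMonoidHom.comp ι)
  have hf : Function.Injective f := N.subtype_injective.comp (e.symm.injective.comp hι)
  rw [← range_eq_inn hf]
  exact exists_congr fun a => Subtype.coe_injective.eq_iff.trans e.symm.injective.eq_iff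

theorem inn_le_of_mulEquiv {X : Type*} [Group X] {N : Subgroup (MulAut A6)} (e : N ≃* X)
    {ι : A6 →* X} (hι : Function.Injective ι) : inn ≤ N := by
  rw [← range_eq_inn (f := N.subtype.comp (e.symm.toMonoidHom.comp ι))
    (N.subtype_injective.comp (e.symm.injective.comp hι))]
  rintro _ ⟨a, rfl⟩
  exact (e.symm (ι a)).2

theorem exists_notMem_inn_orderOf_eq_iff {X : Type*} [Group X] {N : Subgroup (MulAut A6)}
    (e : N ≃* X) {ι : A6 →* X} (hι : Function.Injective ι) (n : ℕ) :
    (∃ g ∈ N, g ∉ inn ∧ orderOf g = n) ↔ ∃ x ∉ ι.range, orderOf x = n := by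
  constructor
  · rintro ⟨g, hg, hgi, hn⟩
    refine ⟨e ⟨g, hg⟩, fun h => hgi ?_, ?_⟩
    · have := (coe_symm_mem_inn_iff e hι _).2 h
      rwa [e.symm_apply_apply] at this
    · rwa [MulEquiv.orderOf_eq, Subgroup.orderOf_mk]
  · rintro ⟨x, hx, hn⟩
    refine ⟨e.symm x, SetLike.coe_mem _, mt (coe_symm_mem_inn_iff e hι x).1 hx, ?_⟩
    rw [Subgroup.orderOf_coe, MulEquiv.orderOf_eq, hn]

theorem exists_orderOf_eq_iff {X Y : Type*} [Group X] [Group Y] (e : X ≃* Y) (n : ℕ) :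
    (∃ x : X, orderOf x = n) ↔ ∃ y : Y, orderOf y = n :=
  e.toEquiv.exists_congr fun x => by rw [← e.orderOf_eq x]; rfl

theorem isCandidate_PGL29_iff {N : Subgroup (MulAut A6)} :
    IsCandidate .PGL29 N ↔ Nonempty (N ≃* PGL(2, F9)) := by
  obtain ⟨j⟩ := nonempty_PGL_F9_equiv
  exact ⟨fun ⟨e⟩ => ⟨e.trans j.symm⟩, fun ⟨e⟩ => ⟨e.trans j⟩⟩

theorem exists_isCandidate (k : Kind) : ∃ N, IsCandidate k N := by
  cases k with
  | A6 => exact ⟨inn, ⟨(MonoidHom.ofInjective conj_A6_injective).symm⟩⟩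
  | S6 => exact ⟨symAut.range, ⟨(MonoidHom.ofInjective symAut_injective).symm⟩⟩
  | PGL29 =>
    obtain ⟨c, hc⟩ := exists_injective_mulAut_PGL
    exact ⟨c.range, isCandidate_PGL29_iff.2 ⟨(MonoidHom.ofInjective hc).symm⟩⟩
  | M10 =>
    obtain ⟨c, hc⟩ := exists_injective_mulAut_M10
    exact ⟨c.range, ⟨(MonoidHom.ofInjective hc).symm⟩⟩

namespace IsCandidate

variable {k k' : Kind} {N N' : Subgroup (MulAut A6)}

theorem inn_le (hN : IsCandidate k N) : inn ≤ N := by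
  cases k with
  | A6 => exact inn_le_of_mulEquiv hN.some (ι := .id A6) Function.injective_id
  | S6 => exact inn_le_of_mulEquiv hN.some (alternatingGroup (Fin 6)).subtype_injective
  | PGL29 =>
    obtain ⟨ι, hι, -⟩ := exists_injective_PGL
    exact inn_le_of_mulEquiv (isCandidate_PGL29_iff.1 hN).some hι
  | M10 =>
    obtain ⟨ι, hι, -⟩ := exists_injective_M10
    exact inn_le_of_mulEquiv hN.some hι

theorem eq_inn (hN : IsCandidate .A6 N) : N = inn := by
  refine (Subgroup.eq_of_le_of_card_ge hN.inn_le ?_).symm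
  rw [Nat.card_congr hN.some.toEquiv, card_A6, inn, card_range_of_injective conj_A6_injective]

theorem card_eq (hN : IsCandidate k N) (hk : k ≠ .A6) : Nat.card N = 720 := by
  cases k with
  | A6 => exact absurd rfl hk
  | S6 => rw [Nat.card_congr hN.some.toEquiv, card_perm_six]
  | PGL29 => rw [Nat.card_congr (isCandidate_PGL29_iff.1 hN).some.toEquiv, card_PGL_F9]
  | M10 => rw [Nat.card_congr hN.some.toEquiv, card_M10]

theorem index_eq_two (hN : IsCandidate k N) (hk : k ≠ .A6) : N.index = 2 := by
  have card_mul_index := N.card_mul_index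
  rw [hN.card_eq hk, card_mulAut_A6] at card_mul_index
  omega

theorem exists_orderOf_eq_eight_iff (hN : IsCandidate k N) :
    (∃ x : N, orderOf x = 8) ↔ k = .PGL29 ∨ k = .M10 := by
  cases k with
  | A6 =>
    rw [exists_orderOf_eq_iff hN.some]
    exact iff_of_false (fun ⟨a, ha⟩ => orderOf_A6_ne_eight a ha) (by simp)
  | S6 =>
    rw [exists_orderOf_eq_iff hN.some]
    exact iff_of_false (fun ⟨σ, hσ⟩ => orderOf_ne_eight σ hσ) (by simp)
  | PGL29 =>
    rw [exists_orderOf_eq_iff (isCandidate_PGL29_iff.1 hN).some]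
    exact iff_of_true ⟨_, orderOf_mk_glEight⟩ (by simp)
  | M10 =>
    rw [exists_orderOf_eq_iff hN.some]
    exact iff_of_true ⟨_, orderOf_m10Eight⟩ (by simp)

theorem exists_orderOf_eq_ten (hN : IsCandidate .PGL29 N) : ∃ h ∈ N, orderOf h = 10 := by
  obtain ⟨e⟩ := isCandidate_PGL29_iff.1 hN
  refine ⟨e.symm (.mk glTen), SetLike.coe_mem _, ?_⟩
  rw [Subgroup.orderOf_coe, MulEquiv.orderOf_eq, orderOf_mk_glTen]

theorem exists_notMem_inn_orderOf_eq_four_iff (hN : IsCandidate k N) :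
    (∃ g ∈ N, g ∉ inn ∧ orderOf g = 4) ↔ k = .S6 ∨ k = .M10 := by
  cases k with
  | A6 =>
    rw [hN.eq_inn]
    exact iff_of_false (fun ⟨_, hg, hgi, _⟩ => hgi hg) (by simp)
  | S6 =>
    rw [exists_notMem_inn_orderOf_eq_iff hN.some (alternatingGroup (Fin 6)).subtype_injective]
    refine iff_of_true ⟨c[0, 1, 2, 3], ?_, ?_⟩ (by simp)
    · rw [Subgroup.range_subtype, Perm.mem_alternatingGroup]
      decide
    · exact orderOf_eq_prime_pow (p := 2) (n := 1) (by decide) (by decide)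
  | PGL29 =>
    obtain ⟨ι, hι, mem_range⟩ := exists_injective_PGL
    rw [exists_notMem_inn_orderOf_eq_iff (isCandidate_PGL29_iff.1 hN).some hι]
    exact iff_of_false (fun ⟨x, hx, h4⟩ => hx (mem_range x h4)) (by simp)
  | M10 =>
    obtain ⟨ι, hι, w, hw, hwr⟩ := exists_injective_M10
    rw [exists_notMem_inn_orderOf_eq_iff hN.some hι]
    exact iff_of_true ⟨w, hwr, hw⟩ (by simp)

theorem kind_unique (hN : IsCandidate k N) (hN' : IsCandidate k' N) : k = k' := by
  have eight := hN.exists_orderOf_eq_eight_iff.symm.trans hN'.exists_orderOf_eq_eight_iff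
  have four := hN.exists_notMem_inn_orderOf_eq_four_iff.symm.trans
    hN'.exists_notMem_inn_orderOf_eq_four_iff
  cases k <;> cases k' <;> simp_all only [reduceCtorEq, or_false, or_true, iff_false, iff_true,
    not_true_eq_false]

theorem ne_of_kind_ne (hN : IsCandidate k N) (hN' : IsCandidate k' N') (hk : k ≠ k') : N ≠ N' := by
  rintro rfl
  exact hk (hN.kind_unique hN')

theorem eq_of_kind_eq (hN : IsCandidate k N) (hN' : IsCandidate k N') : N = N' := by
  by_cases hk : k = .A6
  · subst hk
    exact hN.eq_inn.trans hN'.eq_inn.symm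
  · obtain ⟨l, m, hl, hm, hkl, hkm, hlm⟩ : ∃ l m : Kind,
        l ≠ .A6 ∧ m ≠ .A6 ∧ k ≠ l ∧ k ≠ m ∧ l ≠ m := by
      cases k
      exacts [absurd rfl hk, ⟨.PGL29, .M10, by simp⟩, ⟨.S6, .M10, by simp⟩, ⟨.S6, .PGL29, by simp⟩]
    obtain ⟨L, hL⟩ := exists_isCandidate l
    obtain ⟨M, hM⟩ := exists_isCandidate m
    have := eq_or_eq_of_index_eq_two index_inn (hL.index_eq_two hl) (hM.index_eq_two hm)
      (hN'.index_eq_two hk) (hN.index_eq_two hk) hL.inn_le hM.inn_le hN'.inn_le hN.inn_le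
      (hL.ne_of_kind_ne hM hlm) (hN'.ne_of_kind_ne hL hkl) (hN'.ne_of_kind_ne hM hkm)
    exact (this.resolve_left (hN.ne_of_kind_ne hL hkl)).resolve_left (hN.ne_of_kind_ne hM hkm)

theorem eq_range_symAut (hN : IsCandidate .S6 N) : N = symAut.range :=
  hN.eq_of_kind_eq ⟨(MonoidHom.ofInjective symAut_injective).symm⟩

theorem eq_inn_or_eq (hN : IsCandidate k N) (hk : k ≠ .A6) {K : Subgroup (MulAut A6)}
    (hK : inn ≤ K) (hKN : K ≤ N) : K = inn ∨ K = N := by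
  refine eq_or_eq_of_relIndex_prime hK hKN ?_
  have relIndex_mul_index := Subgroup.relIndex_mul_index hN.inn_le
  rw [hN.index_eq_two hk, index_inn] at relIndex_mul_index
  rw [show inn.relIndex N = 2 by omega]
  exact Nat.prime_two

end IsCandidate

theorem sq_mem_inn (φ : MulAut A6) : φ ^ 2 ∈ inn := by
  obtain ⟨S, hS⟩ := exists_isCandidate .S6
  obtain ⟨M, hM⟩ := exists_isCandidate .M10
  have index_S := hS.index_eq_two (by simp)
  have index_M := hM.index_eq_two (by simp)
  rw [← inf_eq_of_index_eq_two index_inn index_S index_M hS.inn_le hM.inn_le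
    (hS.ne_of_kind_ne hM (by simp))]
  exact ⟨Subgroup.sq_mem_of_index_two index_S φ, Subgroup.sq_mem_of_index_two index_M φ⟩

theorem exists_isCandidate_inn_sup_zpowers (φ : MulAut A6) :
    ∃ k, IsCandidate k (inn ⊔ Subgroup.zpowers φ) := by
  obtain ⟨S, hS⟩ := exists_isCandidate .S6
  obtain ⟨P, hP⟩ := exists_isCandidate .PGL29
  obtain ⟨M, hM⟩ := exists_isCandidate .M10
  have isCandidate_of_mem {l} {L : Subgroup (MulAut A6)} (hL : IsCandidate l L) (hl : l ≠ .A6)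
      (hφ : φ ∈ L) : ∃ k, IsCandidate k (inn ⊔ Subgroup.zpowers φ) := by
    rcases hL.eq_inn_or_eq hl le_sup_left (sup_le hL.inn_le (Subgroup.zpowers_le.2 hφ)) with h | h
    · exact ⟨.A6, by rw [h]; exact ⟨(MonoidHom.ofInjective conj_A6_injective).symm⟩⟩
    · exact ⟨l, by rwa [h]⟩
  rcases mem_or_mem_of_index_eq_two index_inn (hS.index_eq_two (by simp))
    (hP.index_eq_two (by simp)) (hM.index_eq_two (by simp)) hS.inn_le hP.inn_le hM.inn_le
    (hS.ne_of_kind_ne hP (by simp)) (hM.ne_of_kind_ne hS (by simp))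
    (hM.ne_of_kind_ne hP (by simp)) φ with h | h | h
  · exact isCandidate_of_mem hS (by simp) h
  · exact isCandidate_of_mem hP (by simp) h
  · exact isCandidate_of_mem hM (by simp) h

theorem IsCandidate.exists_isFirstComponent {k : Kind} {N : Subgroup (MulAut A6)}
    (hN : IsCandidate k N) : ∃ g, IsFirstComponent k N g := by
  cases k with
  | A6 => exact ⟨1, rfl⟩
  | S6 => exact ⟨_, rfl⟩
  | PGL29 =>
    obtain ⟨h, hh, h10⟩ := hN.exists_orderOf_eq_ten
    exact ⟨h ^ 5, h, hh, h10, rfl⟩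
  | M10 => exact hN.exists_notMem_inn_orderOf_eq_four_iff.2 (.inr rfl)

namespace IsFirstComponent

variable {k : Kind} {N : Subgroup (MulAut A6)} {g : MulAut A6}

theorem pow_four (hg : IsFirstComponent k N g) : g ^ 4 = 1 := by
  cases k with
  | A6 => rw [show g = 1 from hg, one_pow]
  | S6 =>
    rw [show g = symAut (swap 0 1) from hg, ← map_pow, pow_mul (swap (0 : Fin 6) 1) 2 2,
      pow_two (swap _ _), swap_mul_self, one_pow, map_one]
  | PGL29 =>
    obtain ⟨h, -, h10, rfl⟩ := hg
    rw [← pow_mul, pow_mul h 10 2, ← h10, pow_orderOf_eq_one, one_pow]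
  | M10 => rw [← hg.2.2, pow_orderOf_eq_one]

theorem mem (hN : IsCandidate k N) (hg : IsFirstComponent k N g) : g ∈ N := by
  cases k with
  | A6 => exact (show g = 1 from hg) ▸ one_mem N
  | S6 => exact hN.eq_range_symAut ▸ ⟨_, Eq.symm hg⟩
  | PGL29 =>
    obtain ⟨h, hh, -, rfl⟩ := hg
    exact pow_mem hh 5
  | M10 => exact hg.1

theorem notMem_inn (hk : k ≠ .A6) (hg : IsFirstComponent k N g) : g ∉ inn := by
  cases k with
  | A6 => exact absurd rfl hk
  | S6 =>
    rintro ⟨a, ha⟩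
    have coe_eq_swap : (a : Perm (Fin 6)) = swap 0 1 :=
      symAut_injective ((symAut_coe a).trans (ha.trans hg))
    have sign_eq := Perm.mem_alternatingGroup.1 a.2
    rw [coe_eq_swap, Perm.sign_swap (by decide)] at sign_eq
    exact absurd sign_eq (by decide)
  | PGL29 =>
    obtain ⟨h, -, h10, rfl⟩ := hg
    intro h5
    have h_mem : h ∈ inn := by
      have := mul_mem h5 (inv_mem (pow_mem (sq_mem_inn h) 2))
      rwa [← pow_mul, pow_succ' h 4, mul_inv_cancel_right] at this
    obtain ⟨a, rfl⟩ := h_mem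
    have orderOf_a : orderOf a = 10 :=
      (orderOf_injective MulAut.conj conj_A6_injective a).symm.trans h10
    rcases orderOf_A6_dvd_twelve_or_eq_five a with h | h <;> rw [orderOf_a] at h <;> norm_num at h
  | M10 => exact hg.2.1

theorem inn_sup_zpowers (hN : IsCandidate k N) (hg : IsFirstComponent k N g) :
    inn ⊔ Subgroup.zpowers g = N := by
  by_cases hk : k = .A6
  · subst hk
    rw [show g = 1 from hg, Subgroup.zpowers_one_eq_bot, sup_bot_eq, hN.eq_inn]
  · refine (hN.eq_inn_or_eq hk le_sup_left
      (sup_le hN.inn_le (Subgroup.zpowers_le.2 (hg.mem hN)))).resolve_left fun h => ?_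
    exact hg.notMem_inn hk (Subgroup.zpowers_le.1 (sup_eq_left.1 h))

end IsFirstComponent

/-! ### Extensions with perfect or centreless kernel -/

section Extension

variable {A G G' Q : Type*} [Group A] [Group G] [Group G']

section Group

variable [Group Q] (S : GroupExtension A G Q)

theorem conjAct_inl (a : A) : S.conjAct (S.inl a) = MulAut.conj a := by
  ext1 b
  apply S.inl_injective
  rw [GroupExtension.inl_conjAct_comm, MulAut.conj_apply, map_mul, map_mul, map_inv]

theorem range_inl_sup_zpowers {x : G} (hx : Subgroup.zpowers (S.rightHom x) = ⊤) :
    S.inl.range ⊔ Subgroup.zpowers x = ⊤ := by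
  rw [S.range_inl_eq_ker_rightHom, sup_comm, ← Subgroup.comap_map_eq, MonoidHom.map_zpowers, hx,
    Subgroup.comap_top]

theorem range_eq_sup_zpowers {H : Type*} [Group H] (f : G →* H) {x : G}
    (hx : Subgroup.zpowers (S.rightHom x) = ⊤) :
    f.range = (f.comp S.inl).range ⊔ Subgroup.zpowers (f x) := by
  rw [MonoidHom.range_eq_map, ← range_inl_sup_zpowers S hx, Subgroup.map_sup,
    MonoidHom.map_zpowers, MonoidHom.range_comp]

theorem range_conjAct {x : G} (hx : Subgroup.zpowers (S.rightHom x) = ⊤) :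
    S.conjAct.range = (MulAut.conj : A →* MulAut A).range ⊔ Subgroup.zpowers (S.conjAct x) := by
  rw [range_eq_sup_zpowers S S.conjAct hx, show S.conjAct.comp S.inl = MulAut.conj from
    MonoidHom.ext (conjAct_inl S)]

/-- The conjugation action on the kernel of an extension, together with the projection to the
quotient: an embedding when the kernel is centreless. -/
noncomputable def toProd : G →* MulAut A × Q := S.conjAct.prod S.rightHom

theorem toProd_injective (hA : Subgroup.center A = ⊥) : Function.Injective (toProd S) := by
  rw [injective_iff_map_eq_one]
  intro x hx
  have x_mem : x ∈ S.inl.range :=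
    S.range_inl_eq_ker_rightHom ▸ MonoidHom.mem_ker.2 (congrArg Prod.snd hx)
  obtain ⟨a, rfl⟩ := x_mem
  have conj_eq_one : MulAut.conj a = 1 := (conjAct_inl S a).symm.trans (congrArg Prod.fst hx)
  rw [conj_injective hA (conj_eq_one.trans (map_one _).symm), map_one]

theorem toProd_comp_inl :
    (toProd S).comp S.inl = (MonoidHom.inl (MulAut A) Q).comp MulAut.conj :=
  MonoidHom.ext fun a => Prod.ext (conjAct_inl S a) (S.rightHom_inl a)

end Group

section CommGroup

variable [CommGroup Q]

theorem range_inl_eq_commutator [Group.IsPerfect A] (S : GroupExtension A G Q) :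
    S.inl.range = commutator G := by
  refine le_antisymm (range_le_of_commutator_le le_rfl S.inl) ?_
  rw [S.range_inl_eq_ker_rightHom]
  exact Abelianization.commutator_subset_ker S.rightHom

theorem exists_conjAct_eq_conj [Group.IsPerfect A] (S : GroupExtension A G Q)
    (S' : GroupExtension A G' Q) (φ : G ≃* G') :
    ∃ α : MulAut A, ∀ x, S'.conjAct (φ x) = α * S.conjAct x * α⁻¹ := by
  have map_range : S.inl.range.map φ.toMonoidHom = S'.inl.range := by
    rw [range_inl_eq_commutator, range_inl_eq_commutator, commutator_def, Subgroup.map_commutator,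
      Subgroup.map_top_of_surjective φ.toMonoidHom φ.surjective, commutator_def]
  let α : MulAut A := (MonoidHom.ofInjective S.inl_injective).trans <|
    (φ.subgroupMap S.inl.range).trans <|
      (MulEquiv.subgroupCongr map_range).trans (MonoidHom.ofInjective S'.inl_injective).symm
  have inl_α (a : A) : S'.inl (α a) = φ (S.inl a) :=
    MonoidHom.apply_ofInjective_symm S'.inl_injective _
  refine ⟨α, fun x => ?_⟩
  rw [eq_mul_inv_iff_mul_eq]
  ext1 a
  apply S'.inl_injective
  rw [MulAut.mul_apply, MulAut.mul_apply, GroupExtension.inl_conjAct_comm, inl_α, inl_α,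
    GroupExtension.inl_conjAct_comm, map_mul, map_mul, map_inv]

theorem range_conjAct_le_of_mulEquiv [Group.IsPerfect A] (S : GroupExtension A G Q)
    (S' : GroupExtension A G' Q) (hS : S.conjAct.range.Normal)
    (φ : G ≃* G') :
    S'.conjAct.range ≤ S.conjAct.range := by
  obtain ⟨α, hα⟩ := exists_conjAct_eq_conj S S' φ
  rintro _ ⟨y, rfl⟩
  obtain ⟨x, rfl⟩ := φ.surjective y
  rw [hα]
  exact hS.conj_mem _ ⟨x, rfl⟩ α

end CommGroup

end Extension

/-! ### The model groups -/

theorem orderOf_zeta4 : orderOf zeta4 = 4 := by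
  rw [← Subgroup.orderOf_coe, ← orderOf_units]
  exact (Complex.isPrimitiveRoot_exp 4 (by norm_num)).eq_orderOf.symm

theorem zpowers_zeta4 : Subgroup.zpowers zeta4 = ⊤ := by
  apply Subgroup.eq_top_of_card_eq
  rw [Nat.card_zpowers, orderOf_zeta4]
  exact (Complex.card_rootsOfUnity 4).symm

/-- The inclusion of `A6 × 1` into `Aut(A6) × Mu4`. -/
def innPair : A6 →* MulAut A6 × Mu4 := (MonoidHom.inl (MulAut A6) Mu4).comp MulAut.conj

theorem range_innPair : innPair.range = inn.prod ⊥ := by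
  rw [innPair, MonoidHom.range_comp, ← inn]
  ext ⟨φ, z⟩
  simp [Subgroup.mem_prod, eq_comm]

theorem model_eq_sup (g : MulAut A6) : model g = innPair.range ⊔ Subgroup.zpowers (lift g) := by
  rw [range_innPair, model]

theorem innPair_mem_model (g : MulAut A6) (a : A6) : innPair a ∈ model g :=
  model_eq_sup g ▸ Subgroup.mem_sup_left ⟨a, rfl⟩

theorem lift_mem_model (g : MulAut A6) : lift g ∈ model g :=
  Subgroup.mem_sup_right (Subgroup.mem_zpowers _)

theorem model_le_prod_top {N : Subgroup (MulAut A6)} {g : MulAut A6} (hN : inn ≤ N) (hg : g ∈ N) :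
    model g ≤ N.prod ⊤ :=
  sup_le (Subgroup.prod_mono hN bot_le)
    (Subgroup.zpowers_le.2 (Subgroup.mem_prod.2 ⟨hg, Subgroup.mem_top _⟩))

theorem model_le_model {g h : MulAut A6} (hgh : g * h⁻¹ ∈ inn) : model g ≤ model h := by
  refine sup_le le_sup_left (Subgroup.zpowers_le.2 ?_)
  have lift_eq : lift g = (g * h⁻¹, 1) * lift h :=
    Prod.ext (inv_mul_cancel_right g h).symm (one_mul zeta4).symm
  rw [lift_eq]
  exact mul_mem (Subgroup.mem_sup_left ⟨hgh, one_mem _⟩) (lift_mem_model h)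

theorem model_eq_model {g h : MulAut A6} (hgh : g * h⁻¹ ∈ inn) : model g = model h :=
  le_antisymm (model_le_model hgh) (model_le_model (by simpa using inv_mem hgh))

theorem model_one : model 1 = inn.prod ⊤ := by
  refine le_antisymm (model_le_prod_top le_rfl (one_mem _)) ?_
  rintro ⟨φ, z⟩ ⟨hφ, -⟩
  obtain ⟨n, rfl⟩ := Subgroup.mem_zpowers_iff.1 (zpowers_zeta4 ▸ Subgroup.mem_top z)
  rw [show (φ, zeta4 ^ n) = (φ, 1) * lift 1 ^ n by ext1 <;> simp [lift]]
  exact mul_mem (Subgroup.mem_sup_left ⟨hφ, one_mem _⟩) (zpow_mem (lift_mem_model 1) n)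

theorem nonempty_model_one_equiv : Nonempty (model 1 ≃* A6 × Mu4) :=
  ⟨((MulEquiv.subgroupCongr model_one).trans (Subgroup.prodEquiv _ _)).trans
    (MulEquiv.prodCongr (MonoidHom.ofInjective conj_A6_injective).symm Subgroup.topEquiv)⟩

theorem orderOf_lift {g : MulAut A6} (hg : g ^ 4 = 1) : orderOf (lift g) = 4 := by
  rw [lift, Prod.orderOf_mk, orderOf_zeta4]
  exact Nat.lcm_eq_right (orderOf_dvd_of_pow_eq_one hg)

theorem lift_zpow_eq_one {g : MulAut A6} (hg : g ^ 4 = 1) {n : ℤ} (hn : zeta4 ^ n = 1) :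
    lift g ^ n = 1 := by
  rw [← orderOf_dvd_iff_zpow_eq_one, orderOf_zeta4] at hn
  rwa [← orderOf_dvd_iff_zpow_eq_one, orderOf_lift hg]

theorem conj_innPair (x : MulAut A6 × Mu4) (a : A6) :
    x * innPair a * x⁻¹ = innPair (x.1 a) := by
  ext1
  · ext1 b
    simp [innPair, MulAut.conj_apply]
  · simp [innPair]

/-- The homomorphism from the abstract semidirect product to `Aut(A6) × Mu4` whose image is
`model g`. -/
noncomputable def semidirectHom (g : MulAut A6) :
    A6 ⋊[action g] Subgroup.zpowers (lift g) →* MulAut A6 × Mu4 :=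
  SemidirectProduct.lift innPair (Subgroup.zpowers (lift g)).subtype fun z =>
    MonoidHom.ext fun a => (conj_innPair z a).symm

theorem range_semidirectHom (g : MulAut A6) : (semidirectHom g).range = model g := by
  rw [model_eq_sup]
  refine le_antisymm ?_ (sup_le ?_ (Subgroup.zpowers_le.2 ?_))
  · rintro _ ⟨x, rfl⟩
    exact Subgroup.mul_mem_sup ⟨x.left, rfl⟩ x.right.2
  · rintro _ ⟨a, rfl⟩
    exact ⟨SemidirectProduct.inl a, SemidirectProduct.lift_inl ..⟩
  · exact ⟨SemidirectProduct.inr ⟨lift g, Subgroup.mem_zpowers _⟩, SemidirectProduct.lift_inr ..⟩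

theorem exists_eq_innPair_of_mem_model {g : MulAut A6} (hg : g ^ 4 = 1) {x : MulAut A6 × Mu4}
    (hx : x ∈ model g) (snd_eq : x.2 = 1) : ∃ a, innPair a = x := by
  rw [← range_semidirectHom] at hx
  obtain ⟨⟨a, ⟨_, n, rfl⟩⟩, rfl⟩ := hx
  change (1 : Mu4) * zeta4 ^ n = 1 at snd_eq
  rw [one_mul] at snd_eq
  refine ⟨a, ?_⟩
  change innPair a = innPair a * lift g ^ n
  rw [lift_zpow_eq_one hg snd_eq, mul_one]

theorem semidirectHom_injective {g : MulAut A6} (hg : g ^ 4 = 1) :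
    Function.Injective (semidirectHom g) := by
  rw [injective_iff_map_eq_one]
  rintro ⟨a, ⟨_, n, rfl⟩⟩ hx
  change innPair a * lift g ^ n = 1 at hx
  have zeta4_zpow : (1 : Mu4) * zeta4 ^ n = 1 := congrArg Prod.snd hx
  have lift_zpow : lift g ^ n = 1 := lift_zpow_eq_one hg ((one_mul _).symm.trans zeta4_zpow)
  rw [lift_zpow, mul_one] at hx
  have conj_eq_one : MulAut.conj a = 1 := congrArg Prod.fst hx
  exact SemidirectProduct.ext (conj_A6_injective (conj_eq_one.trans (map_one _).symm))
    (Subtype.ext lift_zpow)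

theorem exists_semidirect_equiv {g : MulAut A6} (hg : g ^ 4 = 1) :
    ∃ e : A6 ⋊[action g] Subgroup.zpowers (lift g) ≃* model g,
      ∀ x, (e x : MulAut A6 × Mu4) = (MulAut.conj x.left, 1) * (x.right : MulAut A6 × Mu4) :=
  ⟨(MonoidHom.ofInjective (semidirectHom_injective hg)).trans
    (MulEquiv.subgroupCongr (range_semidirectHom g)), fun _ => rfl⟩

/-- The model group as an extension of `Mu4` by `A6`, by the inclusion of `A6 × 1` and the second
projection. -/
noncomputable def modelExtension (g : MulAut A6) (hg : g ^ 4 = 1) :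
    GroupExtension A6 (model g) Mu4 where
  inl := innPair.codRestrict _ (innPair_mem_model g)
  rightHom := (MonoidHom.snd _ _).comp (model g).subtype
  inl_injective _ _ h := conj_A6_injective (congrArg (fun x => x.1.1) h)
  range_inl_eq_ker_rightHom := by
    refine le_antisymm ?_ fun x hx => ?_
    · rintro _ ⟨a, rfl⟩
      rfl
    · obtain ⟨a, ha⟩ := exists_eq_innPair_of_mem_model hg x.2 hx
      exact ⟨a, Subtype.ext ha⟩
  rightHom_surjective z := by
    obtain ⟨n, rfl⟩ := Subgroup.mem_zpowers_iff.1 (zpowers_zeta4 ▸ Subgroup.mem_top z)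
    exact ⟨⟨lift g ^ n, zpow_mem (lift_mem_model g) n⟩, rfl⟩

theorem conjAct_modelExtension {g : MulAut A6} (hg : g ^ 4 = 1) (x : model g) :
    (modelExtension g hg).conjAct x = (x : MulAut A6 × Mu4).1 := by
  ext1 a
  apply (modelExtension g hg).inl_injective
  rw [GroupExtension.inl_conjAct_comm]
  exact Subtype.ext (conj_innPair x a)

theorem range_conjAct_modelExtension {g : MulAut A6} (hg : g ^ 4 = 1) :
    (modelExtension g hg).conjAct.range = inn ⊔ Subgroup.zpowers g := by
  have := range_conjAct (modelExtension g hg) (x := ⟨lift g, lift_mem_model g⟩) zpowers_zeta4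
  rwa [conjAct_modelExtension] at this

theorem IsFirstComponent.range_conjAct_modelExtension {k : Kind} {N : Subgroup (MulAut A6)}
    {g : MulAut A6} (hN : IsCandidate k N) (hg : IsFirstComponent k N g) :
    (modelExtension g hg.pow_four).conjAct.range = N :=
  (A6Ext.range_conjAct_modelExtension hg.pow_four).trans (hg.inn_sup_zpowers hN)

/-! ### Classification of the extensions -/

section Classification

variable {G G' : Type*} [Group G] [Group G']

theorem exists_isCandidate_range_conjAct (S : GroupExtension A6 G Mu4) :
    ∃ k, IsCandidate k S.conjAct.range := by
  obtain ⟨x, hx⟩ := S.rightHom_surjective zeta4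
  rw [range_conjAct S (hx ▸ zpowers_zeta4)]
  exact exists_isCandidate_inn_sup_zpowers (S.conjAct x)

theorem range_toProd (S : GroupExtension A6 G Mu4) {x : G} (hx : S.rightHom x = zeta4) :
    (toProd S).range = model (S.conjAct x) := by
  rw [range_eq_sup_zpowers S (toProd S) (hx ▸ zpowers_zeta4), toProd_comp_inl, model_eq_sup,
    show toProd S x = lift (S.conjAct x) from Prod.ext rfl hx, innPair]

theorem nonempty_equiv_of_range_conjAct_eq {S : GroupExtension A6 G Mu4}
    {S' : GroupExtension A6 G' Mu4} (h : S.conjAct.range = S'.conjAct.range) :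
    Nonempty (G ≃* G') := by
  obtain ⟨x, hx⟩ := S.rightHom_surjective zeta4
  obtain ⟨x', hx'⟩ := S'.rightHom_surjective zeta4
  rw [range_conjAct S (hx ▸ zpowers_zeta4), range_conjAct S' (hx' ▸ zpowers_zeta4)] at h
  have range_eq : (toProd S).range = (toProd S').range := by
    rw [range_toProd S hx, range_toProd S' hx',
      model_eq_model (mul_inv_mem_of_sup_zpowers_eq (H := inn) sq_mem_inn h)]
  exact ⟨(MonoidHom.ofInjective (toProd_injective S center_A6)).trans <|
    (MulEquiv.subgroupCongr range_eq).trans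
      (MonoidHom.ofInjective (toProd_injective S' center_A6)).symm⟩

theorem normal_range_conjAct (S : GroupExtension A6 G Mu4) : S.conjAct.range.Normal := by
  have inn_le : inn ≤ S.conjAct.range := by
    rintro _ ⟨a, rfl⟩
    exact ⟨S.inl a, conjAct_inl S a⟩
  exact .of_commutator_le _ ((commutator_le_of_index_eq_four index_inn).trans inn_le)

theorem nonempty_equiv_iff (S : GroupExtension A6 G Mu4) (S' : GroupExtension A6 G' Mu4) :
    Nonempty (G ≃* G') ↔ S.conjAct.range = S'.conjAct.range := by
  refine ⟨fun ⟨φ⟩ => ?_, nonempty_equiv_of_range_conjAct_eq⟩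
  exact le_antisymm (range_conjAct_le_of_mulEquiv S' S (normal_range_conjAct S') φ.symm)
    (range_conjAct_le_of_mulEquiv S S' (normal_range_conjAct S) φ)

end Classification

end A6Ext

theorem theorem2p3 :
    -- `Aut(A6)` has exactly one subgroup of each of the four kinds
    (∀ k : A6Ext.Kind, ∃! N : Subgroup (MulAut A6Ext.A6), A6Ext.IsCandidate k N) ∧
    -- the four model groups: they exist, are natural semidirect products inside `N × Mu4`,
    -- and are extensions of `Mu4` by `A6` with image `N` in `Aut(A6)`
    (∀ (k : A6Ext.Kind) (N : Subgroup (MulAut A6Ext.A6)), A6Ext.IsCandidate k N →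
      (∃ g, A6Ext.IsFirstComponent k N g) ∧
      ∀ g, A6Ext.IsFirstComponent k N g →
        A6Ext.model g ≤ N.prod ⊤ ∧
        orderOf (A6Ext.lift g) = 4 ∧
        (∃ e : A6Ext.A6 ⋊[A6Ext.action g] Subgroup.zpowers (A6Ext.lift g) ≃* A6Ext.model g,
          ∀ x, (e x : MulAut A6Ext.A6 × A6Ext.Mu4) =
            (MulAut.conj x.left, 1) * (x.right : MulAut A6Ext.A6 × A6Ext.Mu4)) ∧
        (∃ S : GroupExtension A6Ext.A6 (A6Ext.model g) A6Ext.Mu4,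
          (∀ a, (S.inl a : MulAut A6Ext.A6 × A6Ext.Mu4) = (MulAut.conj a, 1)) ∧
          (∀ x, S.rightHom x = (x : MulAut A6Ext.A6 × A6Ext.Mu4).2) ∧
          S.conjAct.range = N)) ∧
    -- for the first kind the model is the full direct product
    (A6Ext.model 1 = A6Ext.inn.prod ⊤ ∧
      Nonempty (A6Ext.model 1 ≃* A6Ext.A6 × A6Ext.Mu4)) ∧
    -- every extension of `Mu4` by `A6` has one of the four images `N`, and is isomorphic to
    -- the model group belonging to that image
    (∀ (G : Type*) [Group G] (S : GroupExtension A6Ext.A6 G A6Ext.Mu4),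
      (∃ k, A6Ext.IsCandidate k S.conjAct.range) ∧
      ∀ k g, A6Ext.IsCandidate k S.conjAct.range →
        A6Ext.IsFirstComponent k S.conjAct.range g → Nonempty (G ≃* A6Ext.model g)) ∧
    -- model groups of different kinds are not isomorphic
    (∀ (k k' : A6Ext.Kind) (N N' : Subgroup (MulAut A6Ext.A6)) (g g' : MulAut A6Ext.A6),
      A6Ext.IsCandidate k N → A6Ext.IsFirstComponent k N g →
      A6Ext.IsCandidate k' N' → A6Ext.IsFirstComponent k' N' g' →
      Nonempty (A6Ext.model g ≃* A6Ext.model g') → k = k') ∧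
    -- two extensions are isomorphic as groups exactly when their images agree
    (∀ (G G' : Type*) [Group G] [Group G'] (S : GroupExtension A6Ext.A6 G A6Ext.Mu4)
      (S' : GroupExtension A6Ext.A6 G' A6Ext.Mu4),
      Nonempty (G ≃* G') ↔ S.conjAct.range = S'.conjAct.range) := by
  refine ⟨fun k => ?_, fun k N hN => ⟨hN.exists_isFirstComponent, fun g hg => ?_⟩,
    ⟨A6Ext.model_one, A6Ext.nonempty_model_one_equiv⟩,
    fun G _ S => ⟨A6Ext.exists_isCandidate_range_conjAct S, fun k g hS hg => ?_⟩,
    fun k k' N N' g g' hN hg hN' hg' e => ?_, fun G G' _ _ => A6Ext.nonempty_equiv_iff⟩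
  · obtain ⟨N, hN⟩ := A6Ext.exists_isCandidate k
    exact ⟨N, hN, fun N' hN' => hN'.eq_of_kind_eq hN⟩
  · exact ⟨A6Ext.model_le_prod_top hN.inn_le (hg.mem hN), A6Ext.orderOf_lift hg.pow_four,
      A6Ext.exists_semidirect_equiv hg.pow_four, A6Ext.modelExtension g hg.pow_four,
      fun _ => rfl, fun _ => rfl, hg.range_conjAct_modelExtension hN⟩
  · exact A6Ext.nonempty_equiv_of_range_conjAct_eq (hg.range_conjAct_modelExtension hS).symm
  · have range_eq := (A6Ext.nonempty_equiv_iff (A6Ext.modelExtension g hg.pow_four)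
      (A6Ext.modelExtension g' hg'.pow_four)).1 e
    rw [hg.range_conjAct_modelExtension hN, hg'.range_conjAct_modelExtension hN'] at range_eq
    exact hN.kind_unique (range_eq ▸ hN')
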